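/- Let $\{W(t)\}_{t\in[0,1]}$ be a family of binary memoryless symmetric (BMS) channels, i.e. channels from $\{\pm1\}$ to the extended reals $\overline{\mathbb R}$ such that the law of the output given input $-1$ is the law of the negative of the output given input $+1$. Assume that the family is ordered by degradation (for $0\le s\le t\le 1$, $W(t)$ is the composition of $W(s)$ with some further channel), that $W(0)$ is perfect (the output determines the input) and that $W(1)$ is uninformative (the output law does not depend on the input). Let $X_{\mathrm u}$ be uniform on $\{\pm1\}$, let $Y_{\mathrm u}(t)$ be its observation through $W(t)$, and put $$\mathcal H(t)=H(X_{\mathrm u}\mid Y_{\mathrm u}(t)),\qquad \mathcal M(t)=\mathbb E\big[(X_{\mathrm u}-\mathbb E[X_{\mathrm u}\mid Y_{\mathrm u}(t)])^2\big],$$ where entropy is measured in bits. Assume that $\mathcal H$ is absolutely continuous on $[0,1]$, with almost everywhere derivative $\mathcal H'$, and that $\mathcal M$ is strictly increasing on $[0,1]$. For each $n\in\mathbb N$ let $\boldsymbol X^{(n)}$ be a random vector in $\{\pm1\}^{N_n}$ with an arbitrary distribution (for instance, uniform on a code), and let $i_n\in\{0,\dots,N_n-1\}$ be an index (for instance $i_n=0$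 for all $n$). For parameters $s_0,\dots,s_{N_n-1}\in[0,1]$ let $\boldsymbol Y^{(n)}(s_0,\dots,s_{N_n-1})$ be the memoryless observation of $\boldsymbol X^{(n)}$ in which the $j$-th symbol is sent through $W(s_j)$. Write $\boldsymbol Y^{(n)}_{\sim i}(t)$ for the outputs at the positions other than $i$ when their parameters all equal $t$, and define the GEXIT function and the extrinsic MMSE function of the symbol $i=i_n$ by $$G^{(n)}(t)=\frac{\partial}{\partial s}H\big(\boldsymbol X^{(n)}\mid Y^{(n)}_{i}(s),\boldsymbol Y^{(n)}_{\sim i}(t)\big)\Big|_{s=t},\qquad M^{(n)}(t)=\mathbb E\Big[\big(X^{(n)}_{i}-\mathbb E[X^{(n)}_{i}\mid \boldsymbol Y^{(n)}_{\sim i}(t)]\big)^2\Big].$$ Then, for every $n$, the derivative defining $G^{(n)}(t)$ exists for almost every $t\in[0,1]$ and $G^{(n)}$ is integrable on $[0,1]$. Moreover, for every $t'\in(0,1)$, $$\int_0^{t'}G^{(n)}(s)\,ds\to0\iff M^{(n)}(s)\to0\ \text{ for all } s\in[0,t'),$$ $$\int_{t'}^{1}\big(\mathcal H'(s)-G^{(n)}(s)\big)\,ds\to0\iff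 M^{(n)}(s)\to1\ \text{ for all } s\in(t',1],$$ where the limits are for $n\to\infty$. -/

import Mathlib

open MeasureTheory ProbabilityTheory Set Filter Topology

noncomputable section

namespace BMS

/-! ### Information measures

The binary alphabet `{+1, -1}` is `ℤˣ`. -/

/-- Conditional Shannon entropy `H(X ∣ Y)`, in bits, of a random variable `X` with values in a
finite set: the expectation of the entropy of the conditional law of `X` given `Y`. -/
def condEntropy {Ω α β : Type*} [MeasurableSpace Ω] [Fintype α] [MeasurableSpace β]
    (μ : Measure Ω) (X : Ω → α) (Y : Ω → β) : ℝ :=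
  (∫ ω, ∑ x : α,
    Real.negMulLog ((μ⟦X ⁻¹' {x} | MeasurableSpace.comap Y inferInstance⟧) ω) ∂μ) / Real.log 2

/-- Minimum mean-squared error `‖X - 𝔼[X ∣ Y]‖₂²` in estimating `X` from `Y`. -/
def mmse {Ω β : Type*} [MeasurableSpace Ω] [MeasurableSpace β]
    (μ : Measure Ω) (X : Ω → ℝ) (Y : Ω → β) : ℝ :=
  ∫ ω, (X ω - (μ[X | MeasurableSpace.comap Y inferInstance]) ω) ^ 2 ∂μ

/-! ### Channels -/

instance : MeasurableSingletonClass ℤˣ :=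
  ⟨fun x => ⟨{(x : ℤ)}, measurableSet_singleton _, by ext y; simp [Units.ext_iff]⟩⟩

/-- A binary-input channel with output alphabet the extended reals is symmetric if
`w(y ∣ +1) = w(-y ∣ -1)`. -/
def IsSymmetric (K : Kernel ℤˣ EReal) : Prop :=
  K (-1) = (K 1).map (fun y => -y)

/-- `L` is stochastically degraded with respect to `K`: it is `K` followed by another channel. -/
def IsDegraded (L K : Kernel ℤˣ EReal) : Prop :=
  ∃ κ : Kernel EReal EReal, IsMarkovKernel κ ∧ L = κ ∘ₖ K

/-- A perfect channel: the input is determined by the output. -/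
def IsPerfect (K : Kernel ℤˣ EReal) : Prop :=
  ∃ f : EReal → ℤˣ, Measurable f ∧ ∀ x, ∀ᵐ y ∂(K x), f y = x

/-- An uninformative channel: the law of the output does not depend on the input. -/
def IsUninformative (K : Kernel ℤˣ EReal) : Prop :=
  ∀ x x', K x = K x'

/-- The channel with input `x : ι → {±1}` whose outputs are independent given `x`, the `j`-th
one being the output of the channel `K j` with input `x j`. -/
def memoryless {ι : Type*} [Fintype ι] (K : ι → Kernel ℤˣ EReal) :
    Kernel (ι → ℤˣ) (ι → EReal) where
  toFun x := Measure.pi fun j => K j (x j)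
  measurable' := measurable_of_countable _

instance {ι : Type*} [Fintype ι] (K : ι → Kernel ℤˣ EReal) [∀ j, IsMarkovKernel (K j)] :
    IsMarkovKernel (memoryless K) :=
  ⟨fun x => by change IsProbabilityMeasure (Measure.pi fun j => K j (x j)); infer_instance⟩

/-! ### Families of channels

A family is indexed by a real parameter of which only the values in `[0, 1]` matter. -/

/-- The joint law of a uniform input `X_u ∈ {±1}` and its observation `Y_u(t)` through `W t`. -/
def uniformLaw (W : ℝ → Kernel ℤˣ EReal) (t : ℝ) : Measure (ℤˣ × EReal) :=
  (PMF.uniformOfFintype ℤˣ).toMeasure ⊗ₘ W t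

/-- The entropy function `𝓗(t) = H(X_u ∣ Y_u(t))`. -/
def entropyFun (W : ℝ → Kernel ℤˣ EReal) (t : ℝ) : ℝ :=
  condEntropy (uniformLaw W t) Prod.fst Prod.snd

/-- The derivative `𝓗'` of the entropy function on `[0, 1]`. -/
def entropyDeriv (W : ℝ → Kernel ℤˣ EReal) (t : ℝ) : ℝ :=
  derivWithin (entropyFun W) (Icc 0 1) t

/-- The MMSE function `𝓜(t) = mmse(X_u ∣ Y_u(t))`. -/
def mmseFun (W : ℝ → Kernel ℤˣ EReal) (t : ℝ) : ℝ :=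
  mmse (uniformLaw W t) (fun ω => ((ω.1 : ℤ) : ℝ)) Prod.snd

/-- A family `(W t)`, `t ∈ [0, 1]`, of BMS channels that is ordered by degradation, from the
perfect channel at `t = 0` to the uninformative channel at `t = 1`, and absolutely continuous. -/
structure IsBMSFamily (W : ℝ → Kernel ℤˣ EReal) : Prop where
  markov : ∀ t ∈ Icc (0 : ℝ) 1, IsMarkovKernel (W t)
  symmetric : ∀ t ∈ Icc (0 : ℝ) 1, IsSymmetric (W t)
  degraded : ∀ s t : ℝ, 0 ≤ s → s ≤ t → t ≤ 1 → IsDegraded (W t) (W s)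
  perfect : IsPerfect (W 0)
  uninformative : IsUninformative (W 1)
  absolutelyContinuous : AbsolutelyContinuousOnInterval (entropyFun W) 0 1

/-! ### Vector inputs -/

/-- The joint law of an input `X ∈ {±1}^N` with distribution `p` and its observation
`Y(s_0, …, s_{N-1})`, in which the `j`-th symbol passes through the channel `W (s j)`. -/
def jointLaw {N : ℕ} (W : ℝ → Kernel ℤˣ EReal) (p : Measure (Fin N → ℤˣ)) (s : Fin N → ℝ) :
    Measure ((Fin N → ℤˣ) × (Fin N → EReal)) :=
  p ⊗ₘ memoryless fun j => W (s j)

/-- `s ↦ H(X ∣ Y_i(s), Y_{∼i}(t))`: the `i`-th channel has parameter `s`, the others `t`. -/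
def partialEntropy {N : ℕ} (W : ℝ → Kernel ℤˣ EReal) (p : Measure (Fin N → ℤˣ)) (i : Fin N)
    (t s : ℝ) : ℝ :=
  condEntropy (jointLaw W p (Function.update (fun _ => t) i s)) Prod.fst Prod.snd

/-- The GEXIT function `G_i(t) = ∂/∂s H(X ∣ Y_i(s), Y_{∼i}(t))` at `s = t`. -/
def gexit {N : ℕ} (W : ℝ → Kernel ℤˣ EReal) (p : Measure (Fin N → ℤˣ)) (i : Fin N) (t : ℝ) : ℝ :=
  derivWithin (partialEntropy W p i t) (Icc 0 1) t

/-- The extrinsic MMSE function `M_i(t) = ‖X_i - 𝔼[X_i ∣ Y_{∼i}(t)]‖₂²`. -/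
def extrinsicMMSE {N : ℕ} (W : ℝ → Kernel ℤˣ EReal) (p : Measure (Fin N → ℤˣ)) (i : Fin N)
    (t : ℝ) : ℝ :=
  mmse (jointLaw W p fun _ => t) (fun ω => ((ω.1 i : ℤ) : ℝ))
    (fun ω (j : {j : Fin N // j ≠ i}) => ω.2 j)

end BMS

end

/-!
Expanding the binary entropy in even powers of the posterior mean gives `𝓗 = ∑ e_k`, where `e_k` is
a positive multiple of `1 - 𝔼[𝔼[X_u ∣ Y_u]^(2k+2)]`, hence nondecreasing by degradation, and `e_0`
is a multiple of `𝓜`. The output of a symmetric channel has a soft bit whose law is symmetric when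
the input is uniform; averaging over its sign shows that `H(X ∣ Y_i(s), Y_{∼i}(t))` equals
`∑ w_k(t) e_k(s)` up to a term that does not depend on `s`, with
`w_k = 1 - 𝔼[𝔼[X_i ∣ Y_{∼i}]^(2k+2)]`. As `𝓗` is absolutely continuous and the `e_k` are monotone,
both series can be differentiated termwise almost everywhere: `𝓗' = ∑ e_k'` and `G = ∑ w_k e_k'`.

The weights are nondecreasing in `t`, `w_0` is the extrinsic MMSE, and `w_0 ≤ w_k ≤ (k + 1) w_0`.
If `w_0 → 0`, then all `w_k → 0` and the integral of `G` tends to `0` by dominated convergence. In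
the other direction, for `s < t'` monotonicity of `w_0` bounds the integral of `G` over `[0, t']`
below by `w_0(s) (e_0(t') - e_0(s))`, whose second factor is positive as `𝓜` is strictly increasing.
The statement about `𝓗' - G` is the same with the weights `1 - w_k`, which are nonincreasing.
-/

noncomputable section

open scoped ENNReal

namespace BMS

/-! ### Series of monotone functions -/

/-- A series of monotone functions `e k` on `[a, b]` whose sum `E` is absolutely continuous. -/
structure IsMonotoneSeries (e : ℕ → ℝ → ℝ) (E : ℝ → ℝ) (a b : ℝ) : Prop where
  le : a ≤ b
  monotoneOn : ∀ k, MonotoneOn (e k) (Icc a b)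
  hasSum : ∀ t ∈ Icc a b, HasSum (fun k => e k t) (E t)
  absolutelyContinuous : AbsolutelyContinuousOnInterval E a b

/-- On `(a, b)`, the function `g` is the termwise derivative of `∑ v k * e k` with the weights
`v k ∈ [0, 1]` held fixed: `g = ∑ v k * (e k)'` almost everywhere. -/
structure IsWeightedDeriv (e : ℕ → ℝ → ℝ) (v : ℕ → ℝ → ℝ) (g : ℝ → ℝ) (a b : ℝ) : Prop where
  aemeasurable : ∀ k, AEMeasurable (v k) (volume.restrict (Ioo a b))
  mem_Icc : ∀ k, ∀ t ∈ Icc a b, v k t ∈ Icc (0 : ℝ) 1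
  ae_hasSum : ∀ᵐ t ∂(volume.restrict (Ioo a b)), HasSum (fun k => v k t * deriv (e k) t) (g t)

theorem eventually_lt_of_hasSum {ι κ : Type*} {l : Filter ι} {f : ι → κ → ℝ} {f' : κ → ℝ}
    {S : ι → ℝ} {S' a : ℝ} (hf₀ : ∀ᶠ i in l, ∀ k, 0 ≤ f i k)
    (hf : ∀ k, Tendsto (fun i => f i k) l (𝓝 (f' k))) (hS : ∀ᶠ i in l, HasSum (f i) (S i))
    (hS' : HasSum f' S') (ha : a < S') : ∀ᶠ i in l, a < S i := by
  obtain ⟨s, hs⟩ := (hS'.eventually (lt_mem_nhds ha)).exists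
  have hlim := tendsto_finsetSum s fun k _ => hf k
  filter_upwards [hlim.eventually (lt_mem_nhds hs), hf₀, hS] with i hi h₀ hSi
  exact hi.trans_le (sum_le_hasSum s (fun k _ => h₀ k) hSi)

/- Fatou's lemma for the weights `w` bounds the limit from below, and for the weights `1 - w` from
above. -/
theorem tendsto_hasSum_mul {ι κ : Type*} {l : Filter ι} {f : ι → κ → ℝ} {f' w : κ → ℝ}
    {S T : ι → ℝ} {S' T' : ℝ} (hw : ∀ k, w k ∈ Icc (0 : ℝ) 1)
    (hf₀ : ∀ᶠ i in l, ∀ k, 0 ≤ f i k) (hf : ∀ k, Tendsto (fun i => f i k) l (𝓝 (f' k)))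
    (hS : ∀ᶠ i in l, HasSum (f i) (S i)) (hS' : HasSum f' S') (hSS' : Tendsto S l (𝓝 S'))
    (hT : ∀ᶠ i in l, HasSum (fun k => w k * f i k) (T i))
    (hT' : HasSum (fun k => w k * f' k) T') : Tendsto T l (𝓝 T') := by
  rw [tendsto_order]
  refine ⟨fun a ha => ?_, fun a ha => ?_⟩
  · exact eventually_lt_of_hasSum (hf₀.mono fun i h k => mul_nonneg (hw k).1 (h k))
      (fun k => (hf k).const_mul (w k)) hT hT' ha
  · have hcompl : ∀ᶠ i in l, S' - (a + T') / 2 < S i - T i := by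
      refine eventually_lt_of_hasSum (f := fun i k => (1 - w k) * f i k)
        (hf₀.mono fun i h k => mul_nonneg (sub_nonneg.2 (hw k).2) (h k))
        (fun k => (hf k).const_mul (1 - w k)) ?_ (S' := S' - T') ?_ (by linarith)
      · filter_upwards [hS, hT] with i hSi hTi
        simpa only [sub_mul, one_mul] using hSi.sub hTi
      · simpa only [sub_mul, one_mul] using hS'.sub hT'
    have hsum : ∀ᶠ i in l, S i < S' + (a - T') / 2 :=
      hSS'.eventually (gt_mem_nhds (by linarith))
    filter_upwards [hcompl, hsum] with i h₁ h₂
    linarith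

theorem aestronglyMeasurable_of_ae_hasSum {α : Type*} [MeasurableSpace α] {μ : Measure α}
    {f : ℕ → α → ℝ} {g : α → ℝ} (hf : ∀ k, AEStronglyMeasurable (f k) μ)
    (hg : ∀ᵐ x ∂μ, HasSum (fun k => f k x) (g x)) : AEStronglyMeasurable g μ :=
  aestronglyMeasurable_of_tendsto_ae atTop
    (fun n => Finset.aestronglyMeasurable_fun_sum (Finset.range n) fun k _ => hf k)
    (hg.mono fun _ h => h.tendsto_sum_nat)

theorem deriv_nonneg_of_monotoneOn_Icc {f : ℝ → ℝ} {a b t : ℝ} (hf : MonotoneOn f (Icc a b))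
    (ht : t ∈ Ioo a b) : 0 ≤ deriv f t := by
  rw [← derivWithin_of_mem_nhds (Icc_mem_nhds ht.1 ht.2)]
  exact hf.derivWithin_nonneg

namespace IsMonotoneSeries

variable {e : ℕ → ℝ → ℝ} {E : ℝ → ℝ} {a b : ℝ}

theorem mono {c d : ℝ} (h : IsMonotoneSeries e E a b) (hac : a ≤ c) (hcd : c ≤ d) (hdb : d ≤ b) :
    IsMonotoneSeries e E c d where
  le := hcd
  monotoneOn k := (h.monotoneOn k).mono (Icc_subset_Icc hac hdb)
  hasSum t ht := h.hasSum t (Icc_subset_Icc hac hdb ht)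
  absolutelyContinuous := h.absolutelyContinuous.mono (by
    rw [uIcc_of_le hcd, uIcc_of_le h.le]
    exact Icc_subset_Icc hac hdb)

theorem monotoneOn_sub_sum (h : IsMonotoneSeries e E a b) (s : Finset ℕ) :
    MonotoneOn (fun t => E t - ∑ k ∈ s, e k t) (Icc a b) := by
  intro x hx y hy hxy
  have hle := sum_le_hasSum s (fun k _ => sub_nonneg.2 (h.monotoneOn k hx hy hxy))
    ((h.hasSum y hy).sub (h.hasSum x hx))
  rw [Finset.sum_sub_distrib] at hle
  linarith

theorem dist_le_dist (h : IsMonotoneSeries e E a b) (k : ℕ) {x y : ℝ} (hx : x ∈ Icc a b)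
    (hy : y ∈ Icc a b) : dist (e k x) (e k y) ≤ dist (E x) (E y) := by
  wlog hxy : x ≤ y generalizing x y
  · rw [dist_comm (e k x), dist_comm (E x)]
    exact this hy hx (le_of_not_ge hxy)
  have hincr := h.monotoneOn_sub_sum {k} hx hy hxy
  simp only [Finset.sum_singleton] at hincr
  rw [dist_comm, dist_comm (E x), Real.dist_eq, Real.dist_eq,
    abs_of_nonneg (sub_nonneg.2 (h.monotoneOn k hx hy hxy))]
  exact le_trans (by linarith) (le_abs_self _)

theorem absolutelyContinuous_term (h : IsMonotoneSeries e E a b) (k : ℕ) :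
    AbsolutelyContinuousOnInterval (e k) a b := by
  have hE := h.absolutelyContinuous
  rw [absolutelyContinuousOnInterval_iff] at hE ⊢
  intro ε hε
  obtain ⟨δ, hδ, hlt⟩ := hE ε hε
  refine ⟨δ, hδ, fun I hI hIδ => (Finset.sum_le_sum fun i hi => ?_).trans_lt (hlt I hI hIδ)⟩
  have hmem := hI.1 i hi
  rw [uIcc_of_le h.le] at hmem
  exact h.dist_le_dist k hmem.1 hmem.2

theorem deriv_nonneg (h : IsMonotoneSeries e E a b) (k : ℕ) {t : ℝ} (ht : t ∈ Ioo a b) :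
    0 ≤ deriv (e k) t :=
  deriv_nonneg_of_monotoneOn_Icc (h.monotoneOn k) ht

theorem ae_differentiableAt (h : IsMonotoneSeries e E a b) :
    ∀ᵐ t ∂(volume.restrict (Ioo a b)),
      DifferentiableAt ℝ E t ∧ ∀ k, DifferentiableAt ℝ (e k) t := by
  have hterm := ae_all_iff.2 fun k => (h.absolutelyContinuous_term k).ae_differentiableAt
  filter_upwards [ae_restrict_mem measurableSet_Ioo,
    ae_restrict_of_ae h.absolutelyContinuous.ae_differentiableAt, ae_restrict_of_ae hterm]
    with t ht hE he
  have ht' : t ∈ uIcc a b := by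
    rw [uIcc_of_le h.le]
    exact Ioo_subset_Icc_self ht
  exact ⟨hE ht', fun k => he k ht'⟩

theorem sum_deriv_le_deriv (h : IsMonotoneSeries e E a b) {t : ℝ} (ht : t ∈ Ioo a b)
    (hE : DifferentiableAt ℝ E t) (he : ∀ k, DifferentiableAt ℝ (e k) t) (s : Finset ℕ) :
    ∑ k ∈ s, deriv (e k) t ≤ deriv E t := by
  have hderiv : HasDerivAt (fun t => E t - ∑ k ∈ s, e k t)
      (deriv E t - ∑ k ∈ s, deriv (e k) t) t :=
    hE.hasDerivAt.sub (HasDerivAt.fun_sum fun k _ => (he k).hasDerivAt)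
  have hnonneg := deriv_nonneg_of_monotoneOn_Icc (h.monotoneOn_sub_sum s) ht
  rw [hderiv.deriv] at hnonneg
  linarith

theorem integrableOn_deriv (h : IsMonotoneSeries e E a b) : IntegrableOn (deriv E) (Ioo a b) := by
  rw [← intervalIntegrable_iff_integrableOn_Ioo_of_le h.le]
  exact h.absolutelyContinuous.intervalIntegrable_deriv

theorem integrableOn_deriv_term (h : IsMonotoneSeries e E a b) (k : ℕ) :
    IntegrableOn (deriv (e k)) (Ioo a b) := by
  rw [← intervalIntegrable_iff_integrableOn_Ioo_of_le h.le]
  exact (h.absolutelyContinuous_term k).intervalIntegrable_deriv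

theorem setIntegral_deriv (h : IsMonotoneSeries e E a b) :
    ∫ t in Ioo a b, deriv E t = E b - E a := by
  rw [← integral_Ioc_eq_integral_Ioo, ← intervalIntegral.integral_of_le h.le,
    h.absolutelyContinuous.integral_deriv_eq_sub]

theorem setIntegral_deriv_term (h : IsMonotoneSeries e E a b) (k : ℕ) :
    ∫ t in Ioo a b, deriv (e k) t = e k b - e k a := by
  rw [← integral_Ioc_eq_integral_Ioo, ← intervalIntegral.integral_of_le h.le,
    (h.absolutelyContinuous_term k).integral_deriv_eq_sub]

/- The sum of the derivatives is at most the derivative of the sum, and both have integral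
`E b - E a`. -/
theorem ae_hasSum_deriv (h : IsMonotoneSeries e E a b) :
    ∀ᵐ t ∂(volume.restrict (Ioo a b)), HasSum (fun k => deriv (e k) t) (deriv E t) := by
  have hsummable : ∀ᵐ t ∂(volume.restrict (Ioo a b)),
      Summable (fun k => deriv (e k) t) ∧ ∑' k, deriv (e k) t ≤ deriv E t := by
    filter_upwards [ae_restrict_mem measurableSet_Ioo, h.ae_differentiableAt] with t ht ⟨hE, he⟩
    have hle := h.sum_deriv_le_deriv ht hE he
    exact ⟨summable_of_sum_le (fun k => h.deriv_nonneg k ht) hle,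
      Real.tsum_le_of_sum_le (fun k => h.deriv_nonneg k ht) hle⟩
  have hnorm : ∀ k, ∫ t in Ioo a b, ‖deriv (e k) t‖ = e k b - e k a := fun k => by
    rw [← h.setIntegral_deriv_term k]
    exact setIntegral_congr_fun measurableSet_Ioo
      fun t ht => Real.norm_of_nonneg (h.deriv_nonneg k ht)
  have hincr : HasSum (fun k => e k b - e k a) (E b - E a) :=
    (h.hasSum b (right_mem_Icc.2 h.le)).sub (h.hasSum a (left_mem_Icc.2 h.le))
  have hint : ∫ t in Ioo a b, ∑' k, deriv (e k) t = ∫ t in Ioo a b, deriv E t := by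
    rw [h.setIntegral_deriv, ← integral_tsum_of_summable_integral_norm h.integrableOn_deriv_term
      (by simpa only [hnorm] using hincr.summable)]
    simpa only [h.setIntegral_deriv_term] using hincr.tsum_eq
  have hintegrable : IntegrableOn (fun t => ∑' k, deriv (e k) t) (Ioo a b) := by
    refine h.integrableOn_deriv.mono' ?_ ?_
    · exact aestronglyMeasurable_of_ae_hasSum
        (fun k => (measurable_deriv (e k)).aestronglyMeasurable)
        (hsummable.mono fun t hs => hs.1.hasSum)
    · filter_upwards [ae_restrict_mem measurableSet_Ioo, hsummable] with t ht hs
      rw [Real.norm_of_nonneg (tsum_nonneg fun k => h.deriv_nonneg k ht)]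
      exact hs.2
  have heq := (integral_eq_iff_of_ae_le hintegrable h.integrableOn_deriv
    (hsummable.mono fun t hs => hs.2)).1 hint
  filter_upwards [hsummable, heq] with t hs ht
  exact ht ▸ hs.1.hasSum

theorem hasDerivAt_of_hasSum_mul {F : ℝ → ℝ} {w : ℕ → ℝ} {t F' : ℝ}
    (h : IsMonotoneSeries e E a b) (ht : t ∈ Ioo a b) (hw : ∀ k, w k ∈ Icc (0 : ℝ) 1)
    (hE : DifferentiableAt ℝ E t) (he : ∀ k, DifferentiableAt ℝ (e k) t)
    (hsum : HasSum (fun k => deriv (e k) t) (deriv E t))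
    (hF : ∀ s ∈ Icc a b, HasSum (fun k => w k * e k s) (F s))
    (hF' : HasSum (fun k => w k * deriv (e k) t) F') : HasDerivAt F F' t := by
  have ht' : t ∈ Icc a b := Ioo_subset_Icc_self ht
  have hmem : ∀ᶠ s in 𝓝[≠] t, s ∈ Icc a b := nhdsWithin_le_nhds (Icc_mem_nhds ht.1 ht.2)
  refine hasDerivAt_iff_tendsto_slope.2 (tendsto_hasSum_mul hw
    (hmem.mono fun s hs k => (h.monotoneOn k).slope_nonneg ht' hs)
    (fun k => hasDerivAt_iff_tendsto_slope.1 (he k).hasDerivAt) ?_ hsum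
    (hasDerivAt_iff_tendsto_slope.1 hE.hasDerivAt) ?_ hF')
  · filter_upwards [hmem] with s hs
    simpa only [slope_def_field] using ((h.hasSum s hs).sub (h.hasSum t ht')).div_const (s - t)
  · filter_upwards [hmem] with s hs
    simpa only [slope_def_field, mul_div_assoc', mul_sub] using
      ((hF s hs).sub (hF t ht')).div_const (s - t)

theorem ae_hasSum_deriv_of_hasSum_mul {F : ℝ → ℝ → ℝ} {w : ℕ → ℝ → ℝ} {c : ℝ → ℝ}
    (h : IsMonotoneSeries e E a b) (hw : ∀ k, ∀ t ∈ Icc a b, w k t ∈ Icc (0 : ℝ) 1)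
    (hF : ∀ t ∈ Icc a b, ∀ s ∈ Icc a b, HasSum (fun k => w k t * e k s) (F t s - c t)) :
    ∀ᵐ t ∂(volume.restrict (Ioo a b)),
      DifferentiableAt ℝ (F t) t ∧ HasSum (fun k => w k t * deriv (e k) t) (deriv (F t) t) := by
  filter_upwards [ae_restrict_mem measurableSet_Ioo, h.ae_differentiableAt, h.ae_hasSum_deriv]
    with t ht ⟨hE, he⟩ hsum
  have ht' : t ∈ Icc a b := Ioo_subset_Icc_self ht
  have hsummable : Summable fun k => w k t * deriv (e k) t :=
    hsum.summable.of_nonneg_of_le (fun k => mul_nonneg (hw k t ht').1 (h.deriv_nonneg k ht))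
      fun k => mul_le_of_le_one_left (h.deriv_nonneg k ht) (hw k t ht').2
  have hderiv : HasDerivAt (F t) (∑' k, w k t * deriv (e k) t) t :=
    (hasDerivAt_sub_const_iff (c t)).1 (h.hasDerivAt_of_hasSum_mul ht (fun k => hw k t ht') hE he
      hsum (hF t ht') hsummable.hasSum)
  exact ⟨hderiv.differentiableAt, hderiv.deriv ▸ hsummable.hasSum⟩

end IsMonotoneSeries

namespace IsWeightedDeriv

variable {e : ℕ → ℝ → ℝ} {E : ℝ → ℝ} {v : ℕ → ℝ → ℝ} {g : ℝ → ℝ} {a b : ℝ}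

theorem mono {c d : ℝ} (h : IsWeightedDeriv e v g a b) (hac : a ≤ c) (hdb : d ≤ b) :
    IsWeightedDeriv e v g c d where
  aemeasurable k := (h.aemeasurable k).mono_set (Ioo_subset_Ioo hac hdb)
  mem_Icc k t ht := h.mem_Icc k t (Icc_subset_Icc hac hdb ht)
  ae_hasSum := ae_restrict_of_ae_restrict_of_subset (Ioo_subset_Ioo hac hdb) h.ae_hasSum

theorem one_sub (h : IsWeightedDeriv e v g a b) (he : IsMonotoneSeries e E a b) :
    IsWeightedDeriv e (fun k t => 1 - v k t) (fun t => derivWithin E (Icc a b) t - g t) a b where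
  aemeasurable k := (h.aemeasurable k).const_sub 1
  mem_Icc k t ht := Icc.mem_iff_one_sub_mem.1 (h.mem_Icc k t ht)
  ae_hasSum := by
    filter_upwards [ae_restrict_mem measurableSet_Ioo, h.ae_hasSum, he.ae_hasSum_deriv]
      with t ht hg hE
    rw [derivWithin_of_mem_nhds (Icc_mem_nhds ht.1 ht.2)]
    simpa only [sub_mul, one_mul] using hE.sub hg

theorem ae_mem_Icc (h : IsWeightedDeriv e v g a b) (he : IsMonotoneSeries e E a b) :
    ∀ᵐ t ∂(volume.restrict (Ioo a b)), g t ∈ Icc 0 (deriv E t) := by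
  filter_upwards [ae_restrict_mem measurableSet_Ioo, h.ae_hasSum, he.ae_hasSum_deriv]
    with t ht hg hE
  have hv := fun k => h.mem_Icc k t (Ioo_subset_Icc_self ht)
  have hd := fun k => he.deriv_nonneg k ht
  exact ⟨hg.nonneg fun k => mul_nonneg (hv k).1 (hd k),
    hasSum_le (fun k => mul_le_of_le_one_left (hd k) (hv k).2) hg hE⟩

theorem aestronglyMeasurable (h : IsWeightedDeriv e v g a b) :
    AEStronglyMeasurable g (volume.restrict (Ioo a b)) :=
  aestronglyMeasurable_of_ae_hasSum
    (fun k => ((h.aemeasurable k).mul (measurable_deriv (e k)).aemeasurable).aestronglyMeasurable)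
    h.ae_hasSum

theorem ae_norm_le (h : IsWeightedDeriv e v g a b) (he : IsMonotoneSeries e E a b) :
    ∀ᵐ t ∂(volume.restrict (Ioo a b)), ‖g t‖ ≤ deriv E t :=
  (h.ae_mem_Icc he).mono fun _ ht => (Real.norm_of_nonneg ht.1).trans_le ht.2

theorem intervalIntegrable (h : IsWeightedDeriv e v g a b) (he : IsMonotoneSeries e E a b) :
    IntervalIntegrable g volume a b := by
  rw [intervalIntegrable_iff_integrableOn_Ioo_of_le he.le]
  exact he.integrableOn_deriv.mono' h.aestronglyMeasurable (h.ae_norm_le he)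

theorem mul_sub_le_integral {V : ℝ} (h : IsWeightedDeriv e v g a b)
    (he : IsMonotoneSeries e E a b) {k : ℕ} (hV : ∀ t ∈ Ioo a b, V ≤ v k t) :
    V * (e k b - e k a) ≤ ∫ t in a..b, g t := by
  have hg := h.intervalIntegrable he
  rw [intervalIntegrable_iff_integrableOn_Ioo_of_le he.le] at hg
  rw [intervalIntegral.integral_of_le he.le, integral_Ioc_eq_integral_Ioo,
    ← he.setIntegral_deriv_term, ← integral_const_mul]
  refine setIntegral_mono_ae_restrict ((he.integrableOn_deriv_term k).const_mul V) hg ?_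
  filter_upwards [ae_restrict_mem measurableSet_Ioo, h.ae_hasSum] with t ht hsum
  calc V * deriv (e k) t ≤ v k t * deriv (e k) t :=
        mul_le_mul_of_nonneg_right (hV t ht) (he.deriv_nonneg k ht)
    _ ≤ g t := le_hasSum hsum k fun j _ =>
        mul_nonneg (h.mem_Icc j t (Ioo_subset_Icc_self ht)).1 (he.deriv_nonneg j ht)

theorem integral_mono_interval {c d : ℝ} (h : IsWeightedDeriv e v g a b)
    (he : IsMonotoneSeries e E a b) (hac : a ≤ c) (hcd : c ≤ d) (hdb : d ≤ b) :
    ∫ t in c..d, g t ≤ ∫ t in a..b, g t := by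
  refine intervalIntegral.integral_mono_interval hac hcd hdb ?_ (h.intervalIntegrable he)
  rw [← restrict_Ioo_eq_restrict_Ioc]
  exact (h.ae_mem_Icc he).mono fun _ ht => ht.1

end IsWeightedDeriv

section SequenceOfWeights

variable {e : ℕ → ℝ → ℝ} {E : ℝ → ℝ} {v : ℕ → ℕ → ℝ → ℝ} {g : ℕ → ℝ → ℝ} {a b : ℝ} {C : ℕ → ℝ}

theorem tendsto_integral_of_tendsto_weights (he : IsMonotoneSeries e E a b)
    (hg : ∀ n, IsWeightedDeriv e (v n) (g n) a b)
    (hv : ∀ t ∈ Ioo a b, ∀ k, Tendsto (fun n => v n k t) atTop (𝓝 0)) :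
    Tendsto (fun n => ∫ t in a..b, g n t) atTop (𝓝 0) := by
  simp_rw [intervalIntegral.integral_of_le he.le, integral_Ioc_eq_integral_Ioo]
  rw [← integral_zero ℝ ℝ (μ := volume.restrict (Ioo a b))]
  refine tendsto_integral_of_dominated_convergence (deriv E) (fun n => (hg n).aestronglyMeasurable)
    he.integrableOn_deriv (fun n => (hg n).ae_norm_le he) ?_
  filter_upwards [ae_restrict_mem measurableSet_Ioo, ae_all_iff.2 fun n => (hg n).ae_hasSum,
    he.ae_hasSum_deriv] with t ht hsum hE
  simp only [← fun n => (hsum n).tsum_eq]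
  rw [← tsum_zero (α := ℝ) (β := ℕ)]
  refine tendsto_tsum_of_dominated_convergence hE.summable (fun k => ?_) ?_
  · simpa only [zero_mul] using (hv t ht k).mul_const (deriv (e k) t)
  · refine Eventually.of_forall fun n k => ?_
    obtain ⟨h₀, h₁⟩ := (hg n).mem_Icc k t (Ioo_subset_Icc_self ht)
    rw [Real.norm_of_nonneg (mul_nonneg h₀ (he.deriv_nonneg k ht))]
    exact mul_le_of_le_one_left (he.deriv_nonneg k ht) h₁

theorem tendsto_integral_of_tendsto_leading_weight (he : IsMonotoneSeries e E a b)
    (hg : ∀ n, IsWeightedDeriv e (v n) (g n) a b)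
    (hC : ∀ n k, ∀ t ∈ Icc a b, v n k t ≤ C k * v n 0 t)
    (hv : ∀ t ∈ Ioo a b, Tendsto (fun n => v n 0 t) atTop (𝓝 0)) :
    Tendsto (fun n => ∫ t in a..b, g n t) atTop (𝓝 0) := by
  refine tendsto_integral_of_tendsto_weights he hg fun t ht k => ?_
  have ht' : t ∈ Icc a b := Ioo_subset_Icc_self ht
  exact squeeze_zero (fun n => ((hg n).mem_Icc k t ht').1) (fun n => hC n k t ht')
    (by simpa only [mul_zero] using (hv t ht).const_mul (C k))

theorem tendsto_zero_of_mul_le {u I : ℕ → ℝ} {c : ℝ} (hc : 0 < c) (hu : ∀ n, 0 ≤ u n)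
    (h : ∀ n, u n * c ≤ I n) (hI : Tendsto I atTop (𝓝 0)) : Tendsto u atTop (𝓝 0) :=
  squeeze_zero hu (fun n => (le_div_iff₀ hc).2 (h n))
    (by simpa only [zero_div] using hI.div_const c)

theorem tendsto_integral_zero_iff_of_monotone_weights (he : IsMonotoneSeries e E a b)
    (he₀ : StrictMonoOn (e 0) (Icc a b)) (hg : ∀ n, IsWeightedDeriv e (v n) (g n) a b)
    (hC : ∀ n k, ∀ t ∈ Icc a b, v n k t ≤ C k * v n 0 t)
    (hv : ∀ n, MonotoneOn (v n 0) (Icc a b)) :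
    Tendsto (fun n => ∫ t in a..b, g n t) atTop (𝓝 0) ↔
      ∀ s ∈ Ico a b, Tendsto (fun n => v n 0 s) atTop (𝓝 0) := by
  refine ⟨fun hI s hs => ?_, fun h => tendsto_integral_of_tendsto_leading_weight he hg hC
    fun t ht => h t ⟨ht.1.le, ht.2⟩⟩
  have hs' : s ∈ Icc a b := ⟨hs.1, hs.2.le⟩
  refine tendsto_zero_of_mul_le (sub_pos.2 (he₀ hs' (right_mem_Icc.2 he.le) hs.2))
    (fun n => ((hg n).mem_Icc 0 s hs').1) (fun n => ?_) hI
  calc v n 0 s * (e 0 b - e 0 s) ≤ ∫ t in s..b, g n t :=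
        ((hg n).mono hs.1 le_rfl).mul_sub_le_integral (he.mono hs.1 hs.2.le le_rfl)
          fun t ht => hv n hs' ⟨hs.1.trans ht.1.le, ht.2.le⟩ ht.1.le
    _ ≤ ∫ t in a..b, g n t := (hg n).integral_mono_interval he hs.1 hs.2.le le_rfl

theorem tendsto_integral_zero_iff_of_antitone_weights (he : IsMonotoneSeries e E a b)
    (he₀ : StrictMonoOn (e 0) (Icc a b)) (hg : ∀ n, IsWeightedDeriv e (v n) (g n) a b)
    (hC : ∀ n k, ∀ t ∈ Icc a b, v n k t ≤ C k * v n 0 t)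
    (hv : ∀ n, AntitoneOn (v n 0) (Icc a b)) :
    Tendsto (fun n => ∫ t in a..b, g n t) atTop (𝓝 0) ↔
      ∀ s ∈ Ioc a b, Tendsto (fun n => v n 0 s) atTop (𝓝 0) := by
  refine ⟨fun hI s hs => ?_, fun h => tendsto_integral_of_tendsto_leading_weight he hg hC
    fun t ht => h t ⟨ht.1, ht.2.le⟩⟩
  have hs' : s ∈ Icc a b := ⟨hs.1.le, hs.2⟩
  refine tendsto_zero_of_mul_le (sub_pos.2 (he₀ (left_mem_Icc.2 he.le) hs' hs.1))
    (fun n => ((hg n).mem_Icc 0 s hs').1) (fun n => ?_) hI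
  calc v n 0 s * (e 0 s - e 0 a) ≤ ∫ t in a..s, g n t :=
        ((hg n).mono le_rfl hs.2).mul_sub_le_integral (he.mono le_rfl hs.1.le hs.2)
          fun t ht => hv n ⟨ht.1.le, ht.2.le.trans hs.2⟩ hs' ht.2.le
    _ ≤ ∫ t in a..b, g n t := (hg n).integral_mono_interval he le_rfl hs.1.le hs.2

end SequenceOfWeights

/-! ### Power series of the binary entropy -/

/-- The gap `log 2 - h` between the maximal entropy of a bit and the entropy (in nats) of a bit with
mean `u`, that is, of the distribution `((1 + u) / 2, (1 - u) / 2)`. -/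
def entropyGap (u : ℝ) : ℝ := -(Real.negMulLog (1 + u) + Real.negMulLog (1 - u)) / 2

/-- The coefficients of the even power series `entropyGap u = ∑ gapCoeff k * u ^ (2 * k + 2)`. -/
def gapCoeff (k : ℕ) : ℝ := 1 / ((2 * k + 1) * (2 * k + 2))

theorem gapCoeff_pos (k : ℕ) : 0 < gapCoeff k := by unfold gapCoeff; positivity

theorem summable_gapCoeff : Summable gapCoeff := by
  refine Summable.of_nonneg_of_le (fun k => (gapCoeff_pos k).le) (fun k => ?_)
    ((summable_nat_add_iff 1).2 (Real.summable_one_div_nat_pow.2 one_lt_two))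
  unfold gapCoeff
  push_cast
  gcongr
  nlinarith [(Nat.cast_nonneg k : (0 : ℝ) ≤ k)]

theorem continuous_entropyGap : Continuous entropyGap := by
  have := Real.continuous_negMulLog
  unfold entropyGap
  fun_prop

theorem hasSum_entropyGap_of_abs_lt_one {u : ℝ} (hu : |u| < 1) :
    HasSum (fun k => gapCoeff k * u ^ (2 * k + 2)) (entropyGap u) := by
  obtain ⟨hlo, hhi⟩ := abs_lt.1 hu
  have hsq : |u ^ 2| < 1 := by
    rw [abs_pow]
    exact pow_lt_one₀ (abs_nonneg _) hu two_ne_zero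
  have hlog : Real.log (1 - u ^ 2) = Real.log (1 + u) + Real.log (1 - u) := by
    rw [← Real.log_mul (by linarith) (by linarith)]
    ring_nf
  have hgap : entropyGap u = u / 2 * (Real.log (1 + u) - Real.log (1 - u)) -
      1 / 2 * -Real.log (1 - u ^ 2) := by
    rw [hlog, entropyGap, Real.negMulLog, Real.negMulLog]
    ring
  rw [hgap]
  refine (((Real.hasSum_log_sub_log_of_abs_lt_one hu).mul_left (u / 2)).sub
    ((Real.hasSum_pow_div_log_of_abs_lt_one hsq).mul_left (1 / 2))).congr_fun fun k => ?_
  have : (2 * (k : ℝ) + 1) ≠ 0 := by positivity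
  have : ((k : ℝ) + 1) ≠ 0 := by positivity
  rw [gapCoeff, ← pow_mul]
  field_simp
  ring

theorem norm_gapCoeff_mul_pow_le {u : ℝ} (hu : u ∈ Icc (-1 : ℝ) 1) (k : ℕ) :
    ‖gapCoeff k * u ^ (2 * k + 2)‖ ≤ gapCoeff k := by
  rw [norm_mul, Real.norm_of_nonneg (gapCoeff_pos k).le, norm_pow, Real.norm_eq_abs]
  exact mul_le_of_le_one_right (gapCoeff_pos k).le
    (pow_le_one₀ (abs_nonneg _) (abs_le.2 hu))

/- Both sides are continuous on `[-1, 1]`, so the identity extends from the open interval. -/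
theorem hasSum_entropyGap {u : ℝ} (hu : u ∈ Icc (-1 : ℝ) 1) :
    HasSum (fun k => gapCoeff k * u ^ (2 * k + 2)) (entropyGap u) := by
  have hcont : ContinuousOn (fun v : ℝ => ∑' k, gapCoeff k * v ^ (2 * k + 2)) (Icc (-1) 1) :=
    continuousOn_tsum (fun k => by fun_prop) summable_gapCoeff
      fun k v hv => norm_gapCoeff_mul_pow_le hv k
  have heq : EqOn (fun v : ℝ => ∑' k, gapCoeff k * v ^ (2 * k + 2)) entropyGap (Ioo (-1) 1) :=
    fun v hv => (hasSum_entropyGap_of_abs_lt_one (abs_lt.2 hv)).tsum_eq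
  have heq' := heq.of_subset_closure hcont continuous_entropyGap.continuousOn Ioo_subset_Icc_self
    (by rw [closure_Ioo (by norm_num)])
  exact (Summable.of_norm_bounded summable_gapCoeff (norm_gapCoeff_mul_pow_le hu)).hasSum_iff.2
    (heq' hu)

theorem entropyGap_one : entropyGap 1 = Real.log 2 := by
  norm_num [entropyGap, Real.negMulLog]

theorem hasSum_gapCoeff : HasSum gapCoeff (Real.log 2) := by
  simpa [entropyGap_one] using hasSum_entropyGap (u := 1) (by simp)

theorem integrable_entropyGap {Ω : Type*} [MeasurableSpace Ω] {μ : Measure Ω}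
    [IsFiniteMeasure μ] {U : Ω → ℝ} (hU : AEStronglyMeasurable U μ)
    (hU₁ : ∀ ω, U ω ∈ Icc (-1 : ℝ) 1) : Integrable (fun ω => entropyGap (U ω)) μ := by
  obtain ⟨C, hC⟩ := isCompact_Icc.exists_bound_of_continuousOn continuous_entropyGap.continuousOn
  exact Integrable.of_bound (continuous_entropyGap.comp_aestronglyMeasurable hU) C
    (ae_of_all _ fun ω => hC _ (hU₁ ω))

theorem hasSum_integral_entropyGap {Ω : Type*} [MeasurableSpace Ω] {μ : Measure Ω}
    [IsFiniteMeasure μ] {U : Ω → ℝ} (hU : AEStronglyMeasurable U μ)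
    (hU₁ : ∀ ω, U ω ∈ Icc (-1 : ℝ) 1) :
    HasSum (fun k => gapCoeff k * ∫ ω, U ω ^ (2 * k + 2) ∂μ) (∫ ω, entropyGap (U ω) ∂μ) := by
  simp_rw [← integral_const_mul]
  exact hasSum_integral_of_dominated_convergence (fun k _ => gapCoeff k)
    (fun k => (hU.pow _).const_mul _)
    (fun k => Eventually.of_forall fun ω => norm_gapCoeff_mul_pow_le (hU₁ ω) k)
    (Eventually.of_forall fun _ => summable_gapCoeff) (integrable_const _)
    (Eventually.of_forall fun ω => hasSum_entropyGap (hU₁ ω))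

/-! ### Entropy of unnormalized distributions -/

/-- The entropy (in nats) of a finite distribution with weights `a`, extended homogeneously to
weights which do not sum to one. -/
def massEntropy {α : Type*} [Fintype α] (a : α → ℝ) : ℝ :=
  ∑ x, Real.negMulLog (a x) - Real.negMulLog (∑ x, a x)

section MassEntropy

variable {α : Type*} [Fintype α]

theorem massEntropy_of_sum_eq_one {a : α → ℝ} (ha : ∑ x, a x = 1) :
    massEntropy a = ∑ x, Real.negMulLog (a x) := by
  rw [massEntropy, ha, Real.negMulLog_one, sub_zero]

theorem massEntropy_smul (c : ℝ) (a : α → ℝ) :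
    massEntropy (fun x => c * a x) = c * massEntropy a := by
  simp_rw [massEntropy, ← Finset.mul_sum, Real.negMulLog_mul, Finset.sum_add_distrib,
    ← Finset.sum_mul, ← Finset.mul_sum]
  ring

theorem continuous_massEntropy : Continuous (massEntropy : (α → ℝ) → ℝ) := by
  have := Real.continuous_negMulLog
  unfold massEntropy
  fun_prop

theorem exists_norm_massEntropy_le (C : ℝ) :
    ∃ B, ∀ a : α → ℝ, (∀ x, a x ∈ Icc 0 C) → ‖massEntropy a‖ ≤ B := by
  obtain ⟨B, hB⟩ :=
    (isCompact_Icc (a := (0 : α → ℝ)) (b := fun _ => C)).exists_bound_of_continuousOn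
      continuous_massEntropy.continuousOn
  exact ⟨B, fun a ha => hB a ⟨fun x => (ha x).1, fun x => (ha x).2⟩⟩

theorem negMulLog_mul_one_add_add (a u : ℝ) :
    Real.negMulLog (a * (1 + u)) + Real.negMulLog (a * (1 - u)) =
      2 * (Real.negMulLog a - a * entropyGap u) := by
  rw [Real.negMulLog_mul, Real.negMulLog_mul, entropyGap]
  ring

/- The sum over both signs is the entropy of `a` observed through a symmetric channel whose output
tilts the weights of `f x = ± 1` by `1 ± d`. -/
theorem massEntropy_mul_one_add_add {a f : α → ℝ} (d : ℝ) (hf : ∀ x, f x = 1 ∨ f x = -1)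
    (ha : ∑ x, a x = 1) :
    massEntropy (fun x => a x * (1 + f x * d)) + massEntropy (fun x => a x * (1 - f x * d)) =
      2 * (massEntropy a - entropyGap d + entropyGap ((∑ x, a x * f x) * d)) := by
  have hgap : ∀ x, entropyGap (f x * d) = entropyGap d := fun x => by
    rcases hf x with h | h <;> rw [h, entropyGap, entropyGap] <;> ring_nf
  have hsum : ∀ s : ℝ, ∑ x, a x * (1 + s * (f x * d)) = 1 * (1 + s * ((∑ x, a x * f x) * d)) :=
    fun s => by
      calc ∑ x, a x * (1 + s * (f x * d)) = ∑ x, (a x + s * (a x * f x * d)) :=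
            Finset.sum_congr rfl fun x _ => by ring
        _ = 1 * (1 + s * ((∑ x, a x * f x) * d)) := by
            rw [Finset.sum_add_distrib, ha, ← Finset.mul_sum, ← Finset.sum_mul, one_mul]
  have hplus := hsum 1
  have hminus := hsum (-1)
  simp only [one_mul, neg_mul, ← sub_eq_add_neg] at hplus hminus
  have hterms : ∑ x, Real.negMulLog (a x * (1 + f x * d)) +
      ∑ x, Real.negMulLog (a x * (1 - f x * d)) =
      2 * (∑ x, Real.negMulLog (a x) - entropyGap d) := by
    simp_rw [← Finset.sum_add_distrib, negMulLog_mul_one_add_add, hgap, ← Finset.mul_sum,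
      Finset.sum_sub_distrib, ← Finset.sum_mul, ha, one_mul]
  have htotal := negMulLog_mul_one_add_add 1 ((∑ x, a x * f x) * d)
  simp only [one_mul, Real.negMulLog_one, zero_sub] at htotal
  rw [massEntropy, massEntropy, hplus, hminus, massEntropy_of_sum_eq_one ha]
  linarith

end MassEntropy

/-! ### Moments of conditional means -/

/-- The moment of order `2 * k + 2` of the conditional mean `𝔼[X ∣ Y]`. -/
def condMoment {Ω β : Type*} [MeasurableSpace Ω] [MeasurableSpace β] (μ : Measure Ω)
    (X : Ω → ℝ) (Y : Ω → β) (k : ℕ) : ℝ :=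
  ∫ ω, (μ[X | MeasurableSpace.comap Y inferInstance]) ω ^ (2 * k + 2) ∂μ

section CondMoment

variable {Ω β : Type*} [MeasurableSpace Ω] [MeasurableSpace β] {μ : Measure Ω}
  {X : Ω → ℝ} {Y : Ω → β}

theorem ae_condExp_mem_Icc (hX : ∀ ω, X ω ∈ Icc (-1 : ℝ) 1) :
    ∀ᵐ ω ∂μ, (μ[X | MeasurableSpace.comap Y inferInstance]) ω ∈ Icc (-1 : ℝ) 1 := by
  filter_upwards [ae_bdd_abs_condExp_of_ae_bdd_abs (m := MeasurableSpace.comap Y inferInstance)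
    (ae_of_all μ fun ω => abs_le.2 (hX ω))] with ω hω using abs_le.1 hω

theorem integrable_condExp_pow [IsFiniteMeasure μ] (hX : ∀ ω, X ω ∈ Icc (-1 : ℝ) 1)
    (hY : Measurable Y) (n : ℕ) :
    Integrable (fun ω => (μ[X | MeasurableSpace.comap Y inferInstance]) ω ^ n) μ := by
  refine Integrable.of_bound
    ((stronglyMeasurable_condExp.mono hY.comap_le).pow n).aestronglyMeasurable 1 ?_
  filter_upwards [ae_condExp_mem_Icc (Y := Y) hX] with ω hω
  rw [norm_pow]
  exact pow_le_one₀ (norm_nonneg _) (abs_le.2 hω)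

variable [IsProbabilityMeasure μ]

theorem condMoment_mem_Icc (hX : ∀ ω, X ω ∈ Icc (-1 : ℝ) 1) (hY : Measurable Y) (k : ℕ) :
    condMoment μ X Y k ∈ Icc 0 1 := by
  refine ⟨integral_nonneg fun ω => Even.pow_nonneg ⟨k + 1, by ring⟩ _, ?_⟩
  calc condMoment μ X Y k ≤ ∫ _, (1 : ℝ) ∂μ :=
        integral_mono_ae (integrable_condExp_pow hX hY _) (integrable_const _) <| by
          filter_upwards [ae_condExp_mem_Icc (Y := Y) hX] with ω hω
          exact (le_abs_self _).trans_eq (abs_pow _ _) |>.trans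
            (pow_le_one₀ (abs_nonneg _) (abs_le.2 hω))
    _ = 1 := by simp

theorem condMoment_le_condMoment_zero (hX : ∀ ω, X ω ∈ Icc (-1 : ℝ) 1) (hY : Measurable Y)
    (k : ℕ) : condMoment μ X Y k ≤ condMoment μ X Y 0 := by
  refine integral_mono_ae (integrable_condExp_pow hX hY _) (integrable_condExp_pow hX hY _) ?_
  filter_upwards [ae_condExp_mem_Icc (Y := Y) hX] with ω hω
  rw [pow_add, mul_zero, zero_add]
  refine mul_le_of_le_one_left (sq_nonneg _) ?_
  rw [pow_mul]
  exact pow_le_one₀ (sq_nonneg _) ((sq_le_one_iff_abs_le_one _).2 (abs_le.2 hω))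

theorem one_sub_condMoment_le (hX : ∀ ω, X ω ∈ Icc (-1 : ℝ) 1) (hY : Measurable Y) (k : ℕ) :
    1 - condMoment μ X Y k ≤ (k + 1) * (1 - condMoment μ X Y 0) := by
  have hint := fun k : ℕ => integrable_condExp_pow (μ := μ) hX hY (2 * k + 2)
  have hbernoulli : ∀ u : ℝ, 1 - u ^ (2 * k + 2) ≤ (k + 1) * (1 - u ^ (2 * 0 + 2)) := fun u => by
    have := one_add_mul_le_pow (a := u ^ 2 - 1) (by linarith [sq_nonneg u]) (k + 1)
    rw [add_sub_cancel, ← pow_mul, Nat.cast_succ, mul_add_one] at this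
    rw [mul_zero, zero_add]
    linarith
  have hcompl : ∀ k : ℕ, 1 - condMoment μ X Y k =
      ∫ ω, (1 - (μ[X | MeasurableSpace.comap Y inferInstance]) ω ^ (2 * k + 2)) ∂μ := fun k => by
    rw [integral_sub (integrable_const _) (hint k), integral_const, probReal_univ, one_smul,
      condMoment]
  rw [hcompl, hcompl, ← integral_const_mul]
  exact integral_mono ((integrable_const _).sub (hint k))
    (((integrable_const _).sub (hint 0)).const_mul _) fun ω => hbernoulli _

theorem mmse_eq_one_sub_condMoment (hX : Measurable X) (hX₁ : ∀ ω, X ω ^ 2 = 1)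
    (hY : Measurable Y) : mmse μ X Y = 1 - condMoment μ X Y 0 := by
  have hbound : ∀ ω, X ω ∈ Icc (-1 : ℝ) 1 := fun ω =>
    abs_le.1 ((sq_le_one_iff_abs_le_one _).1 (hX₁ ω).le)
  have hL2 : MemLp X 2 μ :=
    MemLp.of_bound hX.aestronglyMeasurable 1 (ae_of_all _ fun ω => abs_le.2 (hbound ω))
  have hsq : X ^ 2 = fun _ => (1 : ℝ) := funext hX₁
  calc mmse μ X Y = ∫ ω, (Var[X; μ | MeasurableSpace.comap Y inferInstance]) ω ∂μ :=
        (integral_condExp hY.comap_le).symm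
    _ = ∫ ω, (1 - (μ[X | MeasurableSpace.comap Y inferInstance]) ω ^ (2 * 0 + 2)) ∂μ := by
        refine integral_congr_ae ?_
        filter_upwards [condVar_ae_eq_condExp_sq_sub_sq_condExp hY.comap_le hL2] with ω hω
        rw [hω, hsq, condExp_const hY.comap_le, Pi.sub_apply, Pi.pow_apply]
    _ = 1 - condMoment μ X Y 0 := by
        rw [integral_sub (integrable_const _) (integrable_condExp_pow hbound hY _)]
        simp [condMoment]

end CondMoment

/-! ### Observations through a channel -/

/-- `Y` is the observation through the channel `K` of a random variable `X` with law `p`. -/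
structure IsObservation {Ω α β : Type*} [MeasurableSpace Ω] [MeasurableSpace α]
    [MeasurableSpace β] (μ : Measure Ω) (X : Ω → α) (Y : Ω → β) (p : Measure α)
    (K : Kernel α β) : Prop where
  measurable_input : Measurable X
  measurable_output : Measurable Y
  map_eq : μ.map (fun ω => (X ω, Y ω)) = p ⊗ₘ K

/-- The conditional mean of `f` under the posterior law of the input of the channel `K` given the
output `y`, for an input with law `p`. -/
def posteriorMean {α β : Type*} [MeasurableSpace α] [StandardBorelSpace α] [Nonempty α]
    [MeasurableSpace β] (K : Kernel α β) [IsFiniteKernel K] (p : Measure α) [IsFiniteMeasure p]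
    (f : α → ℝ) (y : β) : ℝ :=
  ∫ x, f x ∂(K†p) y

section Observation

variable {Ω α β γ : Type*} [MeasurableSpace Ω] [MeasurableSpace α] [MeasurableSpace β]
  [MeasurableSpace γ] {μ : Measure Ω} {X : Ω → α} {Y : Ω → β} {p : Measure α} {K : Kernel α β}

theorem isObservation_compProd : IsObservation (p ⊗ₘ K) Prod.fst Prod.snd p K where
  measurable_input := measurable_fst
  measurable_output := measurable_snd
  map_eq := Measure.map_id

theorem IsObservation.comp [IsFiniteMeasure p] [IsFiniteKernel K]
    (h : IsObservation μ X Y p K) {g : β → γ} (hg : Measurable g) :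
    IsObservation μ X (fun ω => g (Y ω)) p (K.map g) where
  measurable_input := h.measurable_input
  measurable_output := hg.comp h.measurable_output
  map_eq := by
    rw [Measure.compProd_map hg, ← h.map_eq, Measure.map_map (by fun_prop)
      (h.measurable_input.prodMk h.measurable_output)]
    rfl

theorem IsObservation.map_output [IsFiniteMeasure p] [IsFiniteKernel K]
    (h : IsObservation μ X Y p K) : μ.map Y = K ∘ₘ p := by
  rw [← Measure.snd_compProd, ← h.map_eq, Measure.snd_map_prodMk h.measurable_input]

variable [StandardBorelSpace α] [Nonempty α] [IsFiniteMeasure p] [IsFiniteKernel K]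

theorem IsObservation.condDistrib_ae_eq [IsFiniteMeasure μ] (h : IsObservation μ X Y p K) :
    condDistrib X Y μ =ᵐ[μ.map Y] K†p := by
  refine condDistrib_ae_eq_of_measure_eq_compProd Y h.measurable_input.aemeasurable ?_
  rw [h.map_output, compProd_posterior_eq_map_swap, ← h.map_eq,
    Measure.map_map measurable_swap (h.measurable_input.prodMk h.measurable_output)]
  rfl

theorem measurable_posteriorMean {f : α → ℝ} (hf : StronglyMeasurable f) :
    Measurable (posteriorMean K p f) :=
  (hf.comp_measurable measurable_snd).integral_kernel_prod_right'.measurable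

theorem IsObservation.condExp_ae_eq [IsFiniteMeasure μ] (h : IsObservation μ X Y p K)
    {f : α → ℝ} (hf : StronglyMeasurable f) (hint : Integrable (fun ω => f (X ω)) μ) :
    μ[fun ω => f (X ω) | MeasurableSpace.comap Y inferInstance] =ᵐ[μ]
      fun ω => posteriorMean K p f (Y ω) := by
  filter_upwards [condExp_ae_eq_integral_condDistrib h.measurable_output
    h.measurable_input.aemeasurable hf hint,
    ae_of_ae_map h.measurable_output.aemeasurable h.condDistrib_ae_eq] with ω hω hω'
  rw [hω, hω', posteriorMean]

theorem IsObservation.condMoment_eq [IsFiniteMeasure μ] (h : IsObservation μ X Y p K)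
    {f : α → ℝ} (hf : StronglyMeasurable f) (hint : Integrable (fun ω => f (X ω)) μ) (k : ℕ) :
    condMoment μ (fun ω => f (X ω)) Y k =
      ∫ y, posteriorMean K p f y ^ (2 * k + 2) ∂(K ∘ₘ p) := by
  have hcongr : condMoment μ (fun ω => f (X ω)) Y k =
      ∫ ω, posteriorMean K p f (Y ω) ^ (2 * k + 2) ∂μ :=
    integral_congr_ae ((h.condExp_ae_eq hf hint).mono fun ω hω => by simp only [hω])
  rw [hcongr, ← h.map_output, integral_map h.measurable_output.aemeasurable
    ((measurable_posteriorMean hf).pow_const _).aestronglyMeasurable]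

end Observation

theorem integrable_pow_of_mem_Icc {Ω : Type*} [MeasurableSpace Ω] {μ : Measure Ω}
    [IsFiniteMeasure μ] {U : Ω → ℝ} (hU : AEStronglyMeasurable U μ)
    (hU₁ : ∀ ω, U ω ∈ Icc (-1 : ℝ) 1) (n : ℕ) : Integrable (fun ω => U ω ^ n) μ := by
  refine Integrable.of_bound (hU.pow n) 1 (ae_of_all _ fun ω => ?_)
  rw [norm_pow]
  exact pow_le_one₀ (norm_nonneg _) (abs_le.2 (hU₁ ω))

theorem integral_pow_le_integral_pow {Ω : Type*} [MeasurableSpace Ω] {μ : Measure Ω}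
    [IsProbabilityMeasure μ] {U : Ω → ℝ} (hU : AEStronglyMeasurable U μ)
    (hU₁ : ∀ ω, U ω ∈ Icc (-1 : ℝ) 1) (k : ℕ) :
    (∫ ω, U ω ∂μ) ^ (2 * k + 2) ≤ ∫ ω, U ω ^ (2 * k + 2) ∂μ := by
  have hint : Integrable U μ := by simpa using integrable_pow_of_mem_Icc hU hU₁ 1
  exact (Even.convexOn_pow ⟨k + 1, by ring⟩).map_integral_le (continuous_pow _).continuousOn
    isClosed_univ (ae_of_all _ fun _ => mem_univ _) hint (integrable_pow_of_mem_Icc hU hU₁ _)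

theorem integral_comp_measure {α β : Type*} [MeasurableSpace α] [MeasurableSpace β]
    {p : Measure α} {K : Kernel α β} {f : β → ℝ} (hf : Integrable f (K ∘ₘ p)) :
    ∫ y, f y ∂(K ∘ₘ p) = ∫ x, ∫ y, f y ∂(K x) ∂p := by
  rw [Measure.comp_eq_comp_const_apply] at hf ⊢
  rw [Kernel.integral_comp hf, Kernel.const_apply]

theorem integrable_integral_comp_measure {α β : Type*} [MeasurableSpace α] [MeasurableSpace β]
    {p : Measure α} {K : Kernel α β} {f : β → ℝ} (hf : Integrable f (K ∘ₘ p)) :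
    Integrable (fun x => ∫ y, f y ∂(K x)) p := by
  rw [Measure.comp_eq_comp_const_apply] at hf
  simpa only [Kernel.const_apply] using hf.integral_comp

section Posterior

variable {α β γ : Type*} [MeasurableSpace α] [StandardBorelSpace α] [Nonempty α]
  [MeasurableSpace β] [MeasurableSpace γ] {p : Measure α} [IsFiniteMeasure p] {K : Kernel α β}
  {f : α → ℝ}

theorem posteriorMean_mem_Icc [IsFiniteKernel K] (hf : ∀ x, f x ∈ Icc (-1 : ℝ) 1) (y : β) :
    posteriorMean K p f y ∈ Icc (-1 : ℝ) 1 := by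
  have : ‖∫ x, f x ∂(K†p) y‖ ≤ 1 * ((K†p) y).real univ :=
    norm_integral_le_of_norm_le_const (ae_of_all _ fun x => abs_le.2 (hf x))
  rw [probReal_univ, mul_one] at this
  exact abs_le.1 this

theorem integrable_posteriorMean_pow [IsFiniteKernel K] {μ : Measure β} [IsFiniteMeasure μ]
    (hf : Measurable f) (hf₁ : ∀ x, f x ∈ Icc (-1 : ℝ) 1) (n : ℕ) :
    Integrable (fun y => posteriorMean K p f y ^ n) μ :=
  integrable_pow_of_mem_Icc (measurable_posteriorMean hf.stronglyMeasurable).aestronglyMeasurable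
    (posteriorMean_mem_Icc hf₁) n

variable [StandardBorelSpace β] [Nonempty β] [IsFiniteKernel K]

theorem posteriorMean_comp_ae_eq {η : Kernel β γ} [IsFiniteKernel η] (hf : Measurable f)
    (hf₁ : ∀ x, f x ∈ Icc (-1 : ℝ) 1) :
    posteriorMean (η ∘ₖ K) p f =ᵐ[η ∘ₘ K ∘ₘ p] posteriorMean η (K ∘ₘ p) (posteriorMean K p f) := by
  filter_upwards [posterior_comp (κ := K) (μ := p) (η := η)] with z hz
  have hint : Integrable f ((K†p ∘ₖ η†(K ∘ₘ p)) z) :=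
    Integrable.of_bound hf.aestronglyMeasurable 1 (ae_of_all _ fun x => abs_le.2 (hf₁ x))
  rw [posteriorMean, hz, Kernel.integral_comp hint]
  rfl

/- Degrading a channel averages its posterior means, so Jensen's inequality applies. -/
theorem integral_posteriorMean_comp_pow_le {η : Kernel β γ} [IsMarkovKernel η]
    (hf : Measurable f) (hf₁ : ∀ x, f x ∈ Icc (-1 : ℝ) 1) (k : ℕ) :
    ∫ z, posteriorMean (η ∘ₖ K) p f z ^ (2 * k + 2) ∂((η ∘ₖ K) ∘ₘ p) ≤
      ∫ y, posteriorMean K p f y ^ (2 * k + 2) ∂(K ∘ₘ p) := by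
  have hint := integrable_posteriorMean_pow (K := K) (p := p)
    (μ := (η†(K ∘ₘ p)) ∘ₘ η ∘ₘ K ∘ₘ p) hf hf₁ (2 * k + 2)
  have hint_comp := integrable_posteriorMean_pow (K := η ∘ₖ K) (p := p)
    (μ := (η ∘ₖ K) ∘ₘ p) hf hf₁ (2 * k + 2)
  rw [← Measure.comp_assoc] at hint_comp ⊢
  have hjensen : ∀ᵐ z ∂(η ∘ₘ K ∘ₘ p), posteriorMean (η ∘ₖ K) p f z ^ (2 * k + 2) ≤
      ∫ y, posteriorMean K p f y ^ (2 * k + 2) ∂(η†(K ∘ₘ p)) z := by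
    filter_upwards [posteriorMean_comp_ae_eq (η := η) (p := p) (K := K) hf hf₁] with z hz
    rw [hz]
    exact integral_pow_le_integral_pow
      (measurable_posteriorMean hf.stronglyMeasurable).aestronglyMeasurable
      (fun y => posteriorMean_mem_Icc hf₁ y) k
  calc ∫ z, posteriorMean (η ∘ₖ K) p f z ^ (2 * k + 2) ∂(η ∘ₘ K ∘ₘ p)
      ≤ ∫ z, ∫ y, posteriorMean K p f y ^ (2 * k + 2) ∂(η†(K ∘ₘ p)) z ∂(η ∘ₘ K ∘ₘ p) :=
        integral_mono_ae hint_comp (integrable_integral_comp_measure hint) hjensen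
    _ = ∫ y, posteriorMean K p f y ^ (2 * k + 2) ∂(K ∘ₘ p) := by
        rw [← integral_comp_measure hint, posterior_comp_self]

end Posterior

/-! ### Conditional entropy of finite inputs -/

section Densities

variable {α β : Type*} [MeasurableSpace α] [MeasurableSpace β]

theorem measurable_posterior_singleton [StandardBorelSpace α] [Nonempty α] {K : Kernel α β}
    [IsFiniteKernel K] {p : Measure α} [IsFiniteMeasure p] (x : α) :
    Measurable fun y => ((K†p) y).real {x} :=
  ((K†p).measurable_coe (measurableSet_singleton x)).ennreal_toReal

theorem smul_eq_withDensity_posterior [StandardBorelSpace α] [Nonempty α] (K : Kernel α β)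
    [IsFiniteKernel K] (p : Measure α) [IsFiniteMeasure p] (x : α) :
    p {x} • K x = (K ∘ₘ p).withDensity fun y => ENNReal.ofReal (((K†p) y).real {x}) := by
  ext s hs
  have hswap : Prod.swap ⁻¹' (s ×ˢ {x}) = ({x} : Set α) ×ˢ s := preimage_swap_prod _ _
  have hreal : ∀ y, ENNReal.ofReal (((K†p) y).real {x}) = (K†p) y {x} := fun y =>
    ofReal_measureReal
  simp_rw [withDensity_apply _ hs, hreal]
  rw [← Measure.compProd_apply_prod hs (measurableSet_singleton x), compProd_posterior_eq_map_swap,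
    Measure.map_apply measurable_swap (hs.prod (measurableSet_singleton x)), hswap,
    Measure.compProd_apply_prod (measurableSet_singleton x) hs, lintegral_singleton,
    Measure.smul_apply, smul_eq_mul, mul_comm]

theorem comp_eq_withDensity_of_smul_eq [Fintype α] [MeasurableSingletonClass α] {K : Kernel α β}
    {p : Measure α} {m : Measure β} {a : α → β → ℝ} (ha : ∀ x, Measurable (a x))
    (ha₀ : ∀ x y, 0 ≤ a x y)
    (h : ∀ x, p {x} • K x = m.withDensity fun y => ENNReal.ofReal (a x y)) :
    K ∘ₘ p = m.withDensity fun y => ENNReal.ofReal (∑ x, a x y) := by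
  rw [Measure.comp_eq_sum_of_countable]
  simp_rw [h]
  rw [← withDensity_tsum fun x => (ha x).ennreal_ofReal]
  congr 1
  ext y
  rw [tsum_fintype, Finset.sum_apply, ENNReal.ofReal_sum_of_nonneg fun x _ => ha₀ x y]

end Densities

section Entropy

variable {Ω α β : Type*} [MeasurableSpace Ω] [Fintype α] [Nonempty α] [MeasurableSpace α]
  [MeasurableSingletonClass α] [MeasurableSpace β] {μ : Measure Ω} [IsFiniteMeasure μ]
  {X : Ω → α} {Y : Ω → β} {p : Measure α} [IsFiniteMeasure p] {K : Kernel α β} [IsFiniteKernel K]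

theorem IsObservation.condEntropy_eq (h : IsObservation μ X Y p K) :
    condEntropy μ X Y =
      (∫ y, massEntropy (fun x => ((K†p) y).real {x}) ∂(K ∘ₘ p)) / Real.log 2 := by
  have hae : ∀ᵐ ω ∂μ, ∑ x, Real.negMulLog
      ((μ⟦X ⁻¹' {x} | MeasurableSpace.comap Y inferInstance⟧) ω) =
      massEntropy fun x => ((K†p) (Y ω)).real {x} := by
    have hcond : ∀ᵐ ω ∂μ, ∀ x, ((condDistrib X Y μ) (Y ω)).real {x} =
        (μ⟦X ⁻¹' {x} | MeasurableSpace.comap Y inferInstance⟧) ω :=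
      ae_all_iff.2 fun x => condDistrib_ae_eq_condExp h.measurable_output h.measurable_input
        (measurableSet_singleton x)
    filter_upwards [hcond, ae_of_ae_map h.measurable_output.aemeasurable h.condDistrib_ae_eq]
      with ω hω hω'
    rw [massEntropy_of_sum_eq_one (by simp)]
    simp_rw [← hω, hω']
  have hmeas : Measurable fun y => massEntropy fun x => ((K†p) y).real {x} :=
    continuous_massEntropy.measurable.comp (measurable_pi_lambda _ measurable_posterior_singleton)
  rw [condEntropy, integral_congr_ae hae, ← h.map_output,
    integral_map h.measurable_output.aemeasurable hmeas.aestronglyMeasurable]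

/- The posterior weights are proportional to `a`, with the density of `K ∘ₘ p` as the constant of
proportionality, and `massEntropy` is homogeneous. -/
theorem integral_massEntropy_posterior_of_smul_eq {m : Measure β} {a : α → β → ℝ}
    (ha : ∀ x, Measurable (a x)) (ha₀ : ∀ x y, 0 ≤ a x y)
    (h : ∀ x, p {x} • K x = m.withDensity fun y => ENNReal.ofReal (a x y)) :
    ∫ y, massEntropy (fun x => ((K†p) y).real {x}) ∂(K ∘ₘ p) =
      ∫ y, massEntropy (fun x => a x y) ∂m := by
  have hsum₀ : ∀ y, 0 ≤ ∑ x, a x y := fun y => Finset.sum_nonneg fun x _ => ha₀ x y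
  have hsum : Measurable fun y => ENNReal.ofReal (∑ x, a x y) := by fun_prop
  have hcomp := comp_eq_withDensity_of_smul_eq ha ha₀ h
  have hprop : ∀ x, ∀ᵐ y ∂m, a x y = (∑ x, a x y) * ((K†p) y).real {x} := fun x => by
    have hfinite : ∫⁻ y, ENNReal.ofReal (a x y) ∂m ≠ ⊤ := by
      rw [← setLIntegral_univ, ← withDensity_apply _ MeasurableSet.univ, ← h x, Measure.smul_apply,
        smul_eq_mul]
      exact ENNReal.mul_ne_top (measure_ne_top _ _) (measure_ne_top _ _)
    have heq := smul_eq_withDensity_posterior K p x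
    rw [h x, hcomp, ← withDensity_mul _ hsum (measurable_posterior_singleton x).ennreal_ofReal,
      withDensity_eq_iff (ha x).ennreal_ofReal.aemeasurable
        (hsum.mul (measurable_posterior_singleton x).ennreal_ofReal).aemeasurable hfinite] at heq
    filter_upwards [heq] with y hy
    rw [Pi.mul_apply, ← ENNReal.ofReal_mul (hsum₀ y)] at hy
    exact (ENNReal.ofReal_eq_ofReal_iff (ha₀ x y) (by have := hsum₀ y; positivity)).1 hy
  rw [hcomp, integral_withDensity_eq_integral_toReal_smul hsum (by simp)]
  refine integral_congr_ae ?_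
  filter_upwards [ae_all_iff.2 hprop] with y hy
  rw [ENNReal.toReal_ofReal (hsum₀ y), smul_eq_mul, ← massEntropy_smul]
  exact congrArg massEntropy (funext fun x => (hy x).symm)

end Entropy

theorem condEntropy_comp_measurableEquiv {Ω α β γ : Type*} [MeasurableSpace Ω] [Fintype α]
    [MeasurableSpace β] [MeasurableSpace γ] {μ : Measure Ω} {X : Ω → α} {Y : Ω → β}
    (e : β ≃ᵐ γ) : condEntropy μ X (fun ω => e (Y ω)) = condEntropy μ X Y := by
  have : MeasurableSpace.comap (fun ω => e (Y ω)) inferInstance =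
      MeasurableSpace.comap Y inferInstance := by
    change MeasurableSpace.comap (e ∘ Y) _ = _
    rw [← MeasurableSpace.comap_comp, e.measurableEmbedding.comap_eq]
  rw [condEntropy, condEntropy, this]

/-! ### Binary-input channels -/

/-- A bit `± 1` as a real number. -/
def bitValue (σ : ℤˣ) : ℝ := ((σ : ℤ) : ℝ)

/-- The law of a uniform bit `X_u`. -/
def uniformBit : Measure ℤˣ := (PMF.uniformOfFintype ℤˣ).toMeasure

instance : IsProbabilityMeasure uniformBit :=
  inferInstanceAs (IsProbabilityMeasure (PMF.uniformOfFintype ℤˣ).toMeasure)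

/-- The soft bit `𝔼[X_u ∣ Y_u = y]` of the output `y` of the channel `L`. -/
def softBit (L : Kernel ℤˣ EReal) [IsFiniteKernel L] : EReal → ℝ :=
  posteriorMean L uniformBit bitValue

/-- The term of order `2 * k + 2` in the even power series of `H(X_u ∣ Y_u)`, in bits, for the
observation of a uniform bit through the channel `L`. -/
def entropyTerm (L : Kernel ℤˣ EReal) (k : ℕ) : ℝ :=
  gapCoeff k *
    (1 - condMoment (uniformBit ⊗ₘ L) (fun ω => bitValue ω.1) Prod.snd k) / Real.log 2

theorem bitValue_eq_one_or (σ : ℤˣ) : bitValue σ = 1 ∨ bitValue σ = -1 := by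
  rcases Int.units_eq_one_or σ with rfl | rfl <;> simp [bitValue]

theorem bitValue_mem_Icc (σ : ℤˣ) : bitValue σ ∈ Icc (-1 : ℝ) 1 := by
  rcases bitValue_eq_one_or σ with h | h <;> rw [h] <;> norm_num

theorem bitValue_sq (σ : ℤˣ) : bitValue σ ^ 2 = 1 := by
  rcases bitValue_eq_one_or σ with h | h <;> rw [h] <;> norm_num

theorem integrable_bitValue_comp {Ω : Type*} [MeasurableSpace Ω] {μ : Measure Ω}
    [IsFiniteMeasure μ] {X : Ω → ℤˣ} (hX : Measurable X) :
    Integrable (fun ω => bitValue (X ω)) μ :=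
  Integrable.of_bound ((measurable_of_countable bitValue).comp hX).aestronglyMeasurable 1
    (ae_of_all _ fun ω => abs_le.2 (bitValue_mem_Icc (X ω)))

theorem uniformBit_singleton (σ : ℤˣ) : uniformBit {σ} = 2⁻¹ := by
  rw [uniformBit, PMF.toMeasure_apply_singleton _ _ (measurableSet_singleton σ)]
  simp

theorem sum_units_int {M : Type*} [AddCommMonoid M] (g : ℤˣ → M) : ∑ σ, g σ = g 1 + g (-1) := by
  rw [UnitsInt.univ, Finset.sum_pair (by decide)]

open scoped ENNReal
section Channel

variable (L : Kernel ℤˣ EReal) [IsMarkovKernel L]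

theorem measurable_softBit : Measurable (softBit L) :=
  measurable_posteriorMean (measurable_of_countable _).stronglyMeasurable

theorem softBit_mem_Icc (y : EReal) : softBit L y ∈ Icc (-1 : ℝ) 1 :=
  posteriorMean_mem_Icc bitValue_mem_Icc y

theorem posterior_uniformBit_real_singleton (σ : ℤˣ) (y : EReal) :
    ((L†uniformBit) y).real {σ} = 2⁻¹ * (1 + bitValue σ * softBit L y) := by
  have hsum : ∑ τ, ((L†uniformBit) y).real {τ} = 1 := by
    rw [sum_measureReal_singleton, Finset.coe_univ, probReal_univ]
  have hmean : softBit L y = ∑ τ, ((L†uniformBit) y).real {τ} • bitValue τ :=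
    integral_fintype .of_finite
  rw [sum_units_int] at hsum hmean
  simp only [bitValue, Units.val_one, Units.val_neg, Int.cast_one, Int.cast_neg, smul_eq_mul]
    at hmean ⊢
  rcases Int.units_eq_one_or σ with rfl | rfl <;>
    simp only [Units.val_one, Units.val_neg, Int.cast_one, Int.cast_neg] <;> linarith

theorem apply_eq_withDensity_softBit (σ : ℤˣ) :
    L σ = (L ∘ₘ uniformBit).withDensity
      fun y => ENNReal.ofReal (1 + bitValue σ * softBit L y) := by
  calc L σ = (2 : ℝ≥0∞) • (uniformBit {σ} • L σ) := by
        rw [uniformBit_singleton, smul_smul,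
          ENNReal.mul_inv_cancel two_ne_zero ENNReal.ofNat_ne_top, one_smul]
    _ = (L ∘ₘ uniformBit).withDensity
          ((2 : ℝ≥0∞) • fun y => ENNReal.ofReal (((L†uniformBit) y).real {σ})) := by
        rw [smul_eq_withDensity_posterior, withDensity_smul' _ _ ENNReal.ofNat_ne_top]
    _ = _ := by
        congr 1
        ext y
        rw [Pi.smul_apply, posterior_uniformBit_real_singleton, smul_eq_mul,
          ← ENNReal.ofReal_ofNat 2, ← ENNReal.ofReal_mul zero_le_two, ← mul_assoc,
          mul_inv_cancel₀ two_ne_zero, one_mul]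

theorem condMoment_uniformBit_eq (k : ℕ) :
    condMoment (uniformBit ⊗ₘ L) (fun ω => bitValue ω.1) Prod.snd k =
      ∫ y, softBit L y ^ (2 * k + 2) ∂(L ∘ₘ uniformBit) :=
  isObservation_compProd.condMoment_eq (measurable_of_countable bitValue).stronglyMeasurable
    (integrable_bitValue_comp measurable_fst) k

theorem massEntropy_posterior_uniformBit (y : EReal) :
    massEntropy (fun σ => ((L†uniformBit) y).real {σ}) =
      Real.log 2 - entropyGap (softBit L y) := by
  have htotal : ∑ σ, ((L†uniformBit) y).real {σ} = 1 := by
    rw [sum_measureReal_singleton, Finset.coe_univ, probReal_univ]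
  have hpair := negMulLog_mul_one_add_add 2⁻¹ (softBit L y)
  have hhalf : Real.negMulLog 2⁻¹ = 2⁻¹ * Real.log 2 := by
    rw [Real.negMulLog, Real.log_inv, neg_mul_neg]
  rw [massEntropy_of_sum_eq_one htotal, sum_units_int]
  simp only [posterior_uniformBit_real_singleton, bitValue, Units.val_one, Units.val_neg,
    Int.cast_one, Int.cast_neg, one_mul, neg_mul, ← sub_eq_add_neg, hpair, hhalf]
  ring

theorem hasSum_entropyTerm :
    HasSum (entropyTerm L) (condEntropy (uniformBit ⊗ₘ L) Prod.fst Prod.snd) := by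
  have hsoft := (measurable_softBit L).aestronglyMeasurable (μ := L ∘ₘ uniformBit)
  rw [isObservation_compProd.condEntropy_eq]
  simp_rw [massEntropy_posterior_uniformBit]
  rw [integral_sub (integrable_const _) (integrable_entropyGap hsoft (softBit_mem_Icc L)),
    integral_const, probReal_univ, one_smul]
  refine ((hasSum_gapCoeff.sub (hasSum_integral_entropyGap hsoft
    (softBit_mem_Icc L))).div_const _).congr_fun fun k => ?_
  rw [entropyTerm, condMoment_uniformBit_eq, mul_one_sub]

theorem entropyTerm_le_of_isDegraded {L' : Kernel ℤˣ EReal} (h : IsDegraded L' L) (k : ℕ) :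
    entropyTerm L k ≤ entropyTerm L' k := by
  obtain ⟨η, _, rfl⟩ := h
  rw [entropyTerm, entropyTerm, condMoment_uniformBit_eq, condMoment_uniformBit_eq]
  have hmoment := integral_posteriorMean_comp_pow_le (K := L) (p := uniformBit) (η := η)
    (measurable_of_countable bitValue) bitValue_mem_Icc k
  exact div_le_div_of_nonneg_right
    (mul_le_mul_of_nonneg_left (sub_le_sub_left hmoment 1) (gapCoeff_pos k).le)
    (Real.log_pos one_lt_two).le

end Channel

theorem map_withDensity_comp {α β : Type*} [MeasurableSpace α] [MeasurableSpace β]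
    {m : Measure α} {g : α → β} {f : β → ℝ≥0∞} (hf : Measurable f) (hg : Measurable g) :
    (m.withDensity (f ∘ g)).map g = (m.map g).withDensity f := by
  ext s hs
  rw [Measure.map_apply hg hs, withDensity_apply _ (hg hs), withDensity_apply _ hs,
    setLIntegral_map hs hf hg]
  rfl

section Symmetric

variable {L : Kernel ℤˣ EReal}

theorem IsSymmetric.map_neg_apply (hL : IsSymmetric L) (σ : ℤˣ) :
    (L σ).map (fun y => -y) = L (-σ) := by
  rcases Int.units_eq_one_or σ with rfl | rfl
  · exact hL.symm
  · rw [hL, Measure.map_map measurable_neg measurable_neg, neg_neg]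
    simp

theorem IsSymmetric.map_neg_comp (hL : IsSymmetric L) :
    (L ∘ₘ uniformBit).map (fun y => -y) = L ∘ₘ uniformBit := by
  simp_rw [Measure.comp_eq_sum_of_countable, Measure.sum_fintype, uniformBit_singleton,
    sum_units_int, Measure.map_add _ _ measurable_neg, Measure.map_smul, hL.map_neg_apply, neg_neg,
    add_comm]

theorem IsSymmetric.softBit_neg_ae_eq [IsMarkovKernel L] (hL : IsSymmetric L) :
    (fun y => softBit L (-y)) =ᵐ[L ∘ₘ uniformBit] fun y => -softBit L y := by
  have hsoft := measurable_softBit L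
  have hdensity : (L ∘ₘ uniformBit).withDensity (fun y => ENNReal.ofReal (1 + softBit L (-y))) =
      (L ∘ₘ uniformBit).withDensity fun y => ENNReal.ofReal (1 + -softBit L y) := by
    have hpos := apply_eq_withDensity_softBit L 1
    have hneg := apply_eq_withDensity_softBit L (-1)
    simp only [bitValue, Units.val_one, Units.val_neg, Int.cast_one, Int.cast_neg, one_mul,
      neg_mul] at hpos hneg
    rw [← hneg, ← hL.map_neg_apply 1, hpos]
    nth_rw 1 [← hL.map_neg_comp]
    rw [← map_withDensity_comp (by fun_prop) measurable_neg]
    simp [Function.comp_def]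
  have hint : Integrable (fun y => 1 + softBit L (-y)) (L ∘ₘ uniformBit) :=
    Integrable.of_bound (Measurable.aestronglyMeasurable (by fun_prop)) 2 (ae_of_all _ fun y => by
      have := softBit_mem_Icc L (-y)
      rw [Real.norm_eq_abs, abs_le]
      constructor <;> linarith [this.1, this.2])
  rw [withDensity_eq_iff (by fun_prop) (by fun_prop) hint.lintegral_lt_top.ne] at hdensity
  filter_upwards [hdensity] with y hy
  have := (softBit_mem_Icc L (-y)).1
  have := (softBit_mem_Icc L y).2
  have := (ENNReal.ofReal_eq_ofReal_iff (by linarith) (by linarith)).1 hy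
  linarith

theorem IsSymmetric.identDistrib_softBit [IsMarkovKernel L] (hL : IsSymmetric L) :
    IdentDistrib (softBit L) (fun y => -softBit L y) (L ∘ₘ uniformBit) (L ∘ₘ uniformBit) where
  aemeasurable_fst := (measurable_softBit L).aemeasurable
  aemeasurable_snd := (measurable_softBit L).neg.aemeasurable
  map_eq := by
    rw [← Measure.map_congr hL.softBit_neg_ae_eq]
    nth_rw 1 [← hL.map_neg_comp]
    exact Measure.map_map (measurable_softBit L) measurable_neg

end Symmetric

/-! ### Observing one more bit -/

theorem identDistrib_prodMk_snd {Ω Ω' : Type*} [MeasurableSpace Ω] [MeasurableSpace Ω']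
    {m : Measure Ω} {ν : Measure Ω'} [SFinite m] [SFinite ν] {D D' : Ω → ℝ}
    (hD : Measurable D) (hD' : Measurable D') (h : IdentDistrib D D' m m) :
    IdentDistrib (fun ω => (D ω.1, ω.2)) (fun ω => (D' ω.1, ω.2)) (m.prod ν) (m.prod ν) where
  aemeasurable_fst := by fun_prop
  aemeasurable_snd := by fun_prop
  map_eq := by
    change (m.prod ν).map (Prod.map D id) = (m.prod ν).map (Prod.map D' id)
    rw [← Measure.map_prod_map _ _ hD measurable_id, ← Measure.map_prod_map _ _ hD' measurable_id,
      h.map_eq]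

theorem integrable_massEntropy {α Ω : Type*} [Fintype α] [MeasurableSpace Ω] {μ : Measure Ω}
    [IsFiniteMeasure μ] {w : α → Ω → ℝ} (hw : ∀ x, Measurable (w x)) {C : ℝ}
    (hwC : ∀ x ω, w x ω ∈ Icc 0 C) : Integrable (fun ω => massEntropy fun x => w x ω) μ := by
  obtain ⟨B, hB⟩ := exists_norm_massEntropy_le (α := α) C
  exact Integrable.of_bound
    (continuous_massEntropy.measurable.comp (measurable_pi_lambda _ hw)).aestronglyMeasurable B
    (ae_of_all _ fun ω => hB _ fun x => hwC x ω)

theorem mul_mem_Icc_neg_one_one {u v : ℝ} (hu : u ∈ Icc (-1 : ℝ) 1) (hv : v ∈ Icc (-1 : ℝ) 1) :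
    u * v ∈ Icc (-1 : ℝ) 1 := by
  rw [mem_Icc, ← abs_le] at hu hv ⊢
  rw [abs_mul]
  exact mul_le_one₀ hu (abs_nonneg v) hv

section Tilt

variable {α Ω Ω' : Type*} [Fintype α] [MeasurableSpace Ω] [MeasurableSpace Ω']
  {m : Measure Ω} {ν : Measure Ω'} {D : Ω → ℝ} {a : α → Ω' → ℝ} {f : α → ℝ}

/- Averaging over the sign of `D`, which the symmetry of its law allows, turns the integrand into
the right-hand side of `massEntropy_mul_one_add_add`. -/
theorem integral_massEntropy_tilt_eq_integral [IsFiniteMeasure m] [IsFiniteMeasure ν]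
    (hD : Measurable D) (hD₁ : ∀ ω, D ω ∈ Icc (-1 : ℝ) 1)
    (hD_symm : IdentDistrib D (fun ω => -D ω) m m) (ha : ∀ x, Measurable (a x))
    (ha₀ : ∀ x y, a x y ∈ Icc (0 : ℝ) 1) (ha₁ : ∀ y, ∑ x, a x y = 1)
    (hf : ∀ x, f x = 1 ∨ f x = -1) :
    ∫ ω, massEntropy (fun x => a x ω.2 * (1 + f x * D ω.1)) ∂(m.prod ν) =
      ∫ ω, (massEntropy (fun x => a x ω.2) - entropyGap (D ω.1) +
        entropyGap ((∑ x, a x ω.2 * f x) * D ω.1)) ∂(m.prod ν) := by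
  let φ : ℝ × Ω' → ℝ := fun z => massEntropy fun x => a x z.2 * (1 + f x * z.1)
  have hφ : Measurable φ :=
    continuous_massEntropy.measurable.comp (measurable_pi_lambda _ fun x => by fun_prop)
  have hsymm := (identDistrib_prodMk_snd (ν := ν) hD hD.neg hD_symm).comp hφ
  have htilt : Integrable (fun ω : Ω × Ω' => φ (D ω.1, ω.2)) (m.prod ν) :=
    integrable_massEntropy (C := 2) (fun x => by fun_prop) fun x ω => by
      obtain ⟨hnonneg, hle⟩ := ha₀ x ω.2
      obtain ⟨hlo, hhi⟩ := hD₁ ω.1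
      rcases hf x with h | h <;> rw [h] <;> constructor <;> nlinarith
  have hpoint : ∀ ω : Ω × Ω', φ (D ω.1, ω.2) + φ (-D ω.1, ω.2) =
      2 * (massEntropy (fun x => a x ω.2) - entropyGap (D ω.1) +
        entropyGap ((∑ x, a x ω.2 * f x) * D ω.1)) := fun ω => by
    simp only [φ, mul_neg, ← sub_eq_add_neg]
    exact massEntropy_mul_one_add_add (D ω.1) hf (ha₁ ω.2)
  have htwo : 2 * ∫ ω, φ (D ω.1, ω.2) ∂(m.prod ν) =
      ∫ ω, (φ (D ω.1, ω.2) + φ (-D ω.1, ω.2)) ∂(m.prod ν) :=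
    (two_mul _).trans ((congrArg _ hsymm.integral_eq).trans
      (integral_add htilt (hsymm.integrable_iff.1 htilt)).symm)
  simp_rw [hpoint, integral_const_mul] at htwo
  exact mul_left_cancel₀ two_ne_zero htwo

theorem integral_massEntropy_tilt [IsProbabilityMeasure m] [IsProbabilityMeasure ν]
    (hD : Measurable D) (hD₁ : ∀ ω, D ω ∈ Icc (-1 : ℝ) 1)
    (hD_symm : IdentDistrib D (fun ω => -D ω) m m) (ha : ∀ x, Measurable (a x))
    (ha₀ : ∀ x y, a x y ∈ Icc (0 : ℝ) 1) (ha₁ : ∀ y, ∑ x, a x y = 1)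
    (hf : ∀ x, f x = 1 ∨ f x = -1) :
    ∫ ω, massEntropy (fun x => a x ω.2 * (1 + f x * D ω.1)) ∂(m.prod ν) =
      ∫ y, massEntropy (fun x => a x y) ∂ν - ∫ ω, entropyGap (D ω) ∂m +
        ∫ ω, entropyGap ((∑ x, a x ω.2 * f x) * D ω.1) ∂(m.prod ν) := by
  have hmean : ∀ y, ∑ x, a x y * f x ∈ Icc (-1 : ℝ) 1 := fun y =>
    (convex_Icc (-1 : ℝ) 1).sum_mem (fun x _ => (ha₀ x y).1) (ha₁ y) fun x _ => by
      rcases hf x with h | h <;> rw [h] <;> norm_num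
  have hprior : Integrable (fun ω : Ω × Ω' => massEntropy fun x => a x ω.2) (m.prod ν) :=
    integrable_massEntropy (fun x => by fun_prop) fun x ω => ha₀ x ω.2
  have hgap : Integrable (fun ω : Ω × Ω' => entropyGap (D ω.1)) (m.prod ν) :=
    integrable_entropyGap (Measurable.aestronglyMeasurable (by fun_prop)) fun ω => hD₁ ω.1
  have hgap_mul : Integrable (fun ω : Ω × Ω' => entropyGap ((∑ x, a x ω.2 * f x) * D ω.1))
      (m.prod ν) :=
    integrable_entropyGap (Measurable.aestronglyMeasurable (by fun_prop)) fun ω =>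
      mul_mem_Icc_neg_one_one (hmean ω.2) (hD₁ ω.1)
  rw [integral_massEntropy_tilt_eq_integral hD hD₁ hD_symm ha ha₀ ha₁ hf,
    integral_add (hprior.sub' hgap) hgap_mul, integral_sub hprior hgap,
    integral_fun_snd (f := fun y => massEntropy fun x => a x y),
    integral_fun_fst (f := fun ω => entropyGap (D ω)), probReal_univ, probReal_univ, one_smul,
    one_smul]

end Tilt

section AddBit

/-- The residual entropy `H(X ∣ Y) - H(c(X) ∣ Y)`, in bits, where `Y` is the observation through `K`
of an input `X` with law `p`, and `c(X)` is a bit of `X`. -/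
def residualEntropy {α β : Type*} [Fintype α] [Nonempty α] [MeasurableSpace α]
    [MeasurableSingletonClass α] [MeasurableSpace β] (K : Kernel α β) [IsFiniteKernel K]
    (p : Measure α) [IsFiniteMeasure p] (c : α → ℤˣ) : ℝ :=
  (∫ y, massEntropy (fun x => ((K†p) y).real {x}) ∂(K ∘ₘ p) -
    (Real.log 2 - ∫ y, entropyGap (posteriorMean K p (fun x => bitValue (c x)) y) ∂(K ∘ₘ p))) /
      Real.log 2

theorem smul_comap_prod_eq_withDensity {α β : Type*} [MeasurableSpace α]
    [StandardBorelSpace α] [Nonempty α] [MeasurableSpace β] {p : Measure α} [IsFiniteMeasure p]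
    {L : Kernel ℤˣ EReal} [IsMarkovKernel L] {K : Kernel α β} [IsFiniteKernel K] {c : α → ℤˣ}
    (hc : Measurable c) (x : α) :
    p {x} • ((L.comap c hc) ×ₖ K) x = ((L ∘ₘ uniformBit).prod (K ∘ₘ p)).withDensity fun y =>
      ENNReal.ofReal (((K†p) y.2).real {x} * (1 + bitValue (c x) * softBit L y.1)) := by
  have hsoft := measurable_softBit L
  have hposterior := measurable_posterior_singleton (K := K) (p := p) x
  rw [Kernel.prod_apply, Kernel.comap_apply, ← Measure.prod_smul_right,
    smul_eq_withDensity_posterior, apply_eq_withDensity_softBit,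
    prod_withDensity (by fun_prop) (by fun_prop)]
  congr 1
  ext y
  rw [ENNReal.ofReal_mul measureReal_nonneg, mul_comm]

variable {Ω α β : Type*} [MeasurableSpace Ω] [Fintype α] [Nonempty α] [MeasurableSpace α]
  [MeasurableSingletonClass α] [MeasurableSpace β] {μ : Measure Ω} {X : Ω → α}
  {Y : Ω → EReal × β} {p : Measure α} [IsProbabilityMeasure p] {L : Kernel ℤˣ EReal}
  [IsMarkovKernel L] {K : Kernel α β} [IsMarkovKernel K] {c : α → ℤˣ}

theorem IsObservation.condEntropy_add_bit [IsFiniteMeasure μ] (hL : IsSymmetric L)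
    (hc : Measurable c) (h : IsObservation μ X Y p ((L.comap c hc) ×ₖ K)) :
    condEntropy μ X Y = (∫ y, massEntropy (fun x => ((K†p) y).real {x}) ∂(K ∘ₘ p) -
      ∫ y, entropyGap (softBit L y) ∂(L ∘ₘ uniformBit) +
      ∫ y, entropyGap (posteriorMean K p (fun x => bitValue (c x)) y.2 * softBit L y.1)
        ∂((L ∘ₘ uniformBit).prod (K ∘ₘ p))) / Real.log 2 := by
  have hsoft := measurable_softBit L
  have hposterior := measurable_posterior_singleton (K := K) (p := p)
  have hmean : ∀ y, posteriorMean K p (fun x => bitValue (c x)) y =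
      ∑ x, ((K†p) y).real {x} * bitValue (c x) := fun y => integral_fintype .of_finite
  have hmeas : ∀ x, Measurable fun y : EReal × β =>
      ((K†p) y.2).real {x} * (1 + bitValue (c x) * softBit L y.1) := fun x =>
    ((hposterior x).comp measurable_snd).mul (by fun_prop)
  have hnonneg : ∀ x (y : EReal × β),
      0 ≤ ((K†p) y.2).real {x} * (1 + bitValue (c x) * softBit L y.1) := fun x y =>
    mul_nonneg measureReal_nonneg (by
      linarith [(mul_mem_Icc_neg_one_one (bitValue_mem_Icc (c x)) (softBit_mem_Icc L y.1)).1])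
  rw [h.condEntropy_eq, integral_massEntropy_posterior_of_smul_eq hmeas hnonneg
    (smul_comap_prod_eq_withDensity hc), integral_massEntropy_tilt hsoft (softBit_mem_Icc L)
    hL.identDistrib_softBit hposterior (fun x y => ⟨measureReal_nonneg, measureReal_le_one⟩)
    (fun y => by rw [sum_measureReal_singleton, Finset.coe_univ, probReal_univ])
    fun x => bitValue_eq_one_or (c x)]
  simp_rw [hmean]

/- As the soft bit and the posterior mean are independent, the even moments of their product
factor. -/
theorem IsObservation.hasSum_condEntropy [IsFiniteMeasure μ] (hL : IsSymmetric L)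
    (hc : Measurable c) (h : IsObservation μ X Y p ((L.comap c hc) ×ₖ K)) :
    HasSum (fun k => (1 - ∫ y, posteriorMean K p (fun x => bitValue (c x)) y ^ (2 * k + 2)
      ∂(K ∘ₘ p)) * entropyTerm L k) (condEntropy μ X Y - residualEntropy K p c) := by
  have hbit : Measurable fun x => bitValue (c x) := (measurable_of_countable bitValue).comp hc
  have hsoft := measurable_softBit L
  have hmean := measurable_posteriorMean (K := K) (p := p) hbit.stronglyMeasurable
  have hmean₁ := posteriorMean_mem_Icc (K := K) (p := p) fun x => bitValue_mem_Icc (c x)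
  have hsum_mean := hasSum_integral_entropyGap (μ := K ∘ₘ p) hmean.aestronglyMeasurable hmean₁
  have hsum_soft := hasSum_integral_entropyGap (μ := L ∘ₘ uniformBit)
    hsoft.aestronglyMeasurable (softBit_mem_Icc L)
  have hsum_mul := hasSum_integral_entropyGap (μ := (L ∘ₘ uniformBit).prod (K ∘ₘ p))
    (U := fun y => softBit L y.1 * posteriorMean K p (fun x => bitValue (c x)) y.2)
    (Measurable.aestronglyMeasurable (by fun_prop))
    fun y => mul_mem_Icc_neg_one_one (softBit_mem_Icc L y.1) (hmean₁ y.2)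
  have hvalue : condEntropy μ X Y - residualEntropy K p c =
      (Real.log 2 - ∫ y, entropyGap (posteriorMean K p (fun x => bitValue (c x)) y) ∂(K ∘ₘ p) -
        ∫ y, entropyGap (softBit L y) ∂(L ∘ₘ uniformBit) +
        ∫ y, entropyGap (softBit L y.1 * posteriorMean K p (fun x => bitValue (c x)) y.2)
          ∂((L ∘ₘ uniformBit).prod (K ∘ₘ p))) / Real.log 2 := by
    rw [h.condEntropy_add_bit hL hc, residualEntropy]
    simp_rw [mul_comm (posteriorMean K p _ _)]
    ring
  rw [hvalue]
  refine ((((hasSum_gapCoeff.sub hsum_mean).sub hsum_soft).add hsum_mul).div_const _).congr_fun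
    fun k => ?_
  have hfactor := integral_prod_mul (μ := L ∘ₘ uniformBit) (ν := K ∘ₘ p)
    (fun y => softBit L y ^ (2 * k + 2))
    fun y => posteriorMean K p (fun x => bitValue (c x)) y ^ (2 * k + 2)
  simp_rw [mul_pow, hfactor]
  rw [entropyTerm, condMoment_uniformBit_eq]
  ring

end AddBit

/-! ### Memoryless channels -/

section Memoryless

variable {ι : Type*} [Fintype ι]

/-- The channel whose outputs are independent given the input `y : ι → EReal`, the `j`-th one being
the output of `κ j` with input `y j`. -/
def coordinatewise (κ : ι → Kernel EReal EReal) [∀ j, IsMarkovKernel (κ j)] :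
    Kernel (ι → EReal) (ι → EReal) where
  toFun y := Measure.pi fun j => κ j (y j)
  measurable' := by
    refine Measurable.measure_of_isPiSystem_of_isProbabilityMeasure generateFrom_pi.symm
      isPiSystem_pi ?_
    rintro _ ⟨S, hS, rfl⟩
    simp_rw [Measure.pi_pi]
    exact Finset.measurable_fun_prod _ fun j _ =>
      ((κ j).measurable_coe (hS j (mem_univ j))).comp (measurable_pi_apply j)

instance (κ : ι → Kernel EReal EReal) [∀ j, IsMarkovKernel (κ j)] :
    IsMarkovKernel (coordinatewise κ) :=
  ⟨fun y => Measure.pi.instIsProbabilityMeasure fun j => κ j (y j)⟩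

theorem lintegral_pi_prod {β : ι → Type*} [∀ j, MeasurableSpace (β j)] (m : ∀ j, Measure (β j))
    [∀ j, IsProbabilityMeasure (m j)] {F : ∀ j, β j → ℝ≥0∞} (hF : ∀ j, Measurable (F j)) :
    ∫⁻ y, ∏ j, F j (y j) ∂(Measure.pi m) = ∏ j, ∫⁻ y, F j y ∂(m j) := by
  have hindep : iIndepFun (fun j (y : ∀ j, β j) => F j (y j)) (Measure.pi m) :=
    iIndepFun_pi fun j => (hF j).aemeasurable
  rw [lintegral_prod_eq_prod_lintegral_of_indepFun _ _ hindep
    fun j => (hF j).comp (measurable_pi_apply j)]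
  exact Finset.prod_congr rfl fun j _ => (measurePreserving_eval m j).lintegral_comp (hF j)

theorem memoryless_comp (K : ι → Kernel ℤˣ EReal) [∀ j, IsMarkovKernel (K j)]
    (κ : ι → Kernel EReal EReal) [∀ j, IsMarkovKernel (κ j)] :
    memoryless (fun j => κ j ∘ₖ K j) = coordinatewise κ ∘ₖ memoryless K := by
  ext1 x
  refine Measure.pi_eq fun S hS => ?_
  rw [Kernel.comp_apply' _ _ _ (.univ_pi hS)]
  change ∫⁻ y, Measure.pi (fun j => κ j (y j)) (univ.pi S) ∂(Measure.pi fun j => K j (x j)) = _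
  simp_rw [Measure.pi_pi, Kernel.comp_apply' _ _ _ (hS _)]
  exact lintegral_pi_prod _ fun j => (κ j).measurable_coe (hS j)

variable [DecidableEq ι]

/-- The measurable equivalence that splits a vector into its `i`-th entry and the other ones. -/
def splitAt (i : ι) (β : Type*) [MeasurableSpace β] :
    (ι → β) ≃ᵐ β × ({j : ι // j ≠ i} → β) :=
  (MeasurableEquiv.piEquivPiSubtypeProd (fun _ => β) (· = i)).trans
    ((MeasurableEquiv.piUnique fun _ => β).prodCongr (.refl _))

theorem measurePreserving_splitAt (i : ι) {β : Type*} [MeasurableSpace β] (m : ι → Measure β)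
    [∀ j, SigmaFinite (m j)] :
    MeasurePreserving (splitAt i β) (Measure.pi m)
      ((m i).prod (Measure.pi fun j : {j : ι // j ≠ i} => m j)) := by
  have hsplit := measurePreserving_piEquivPiSubtypeProd m (· = i)
  rw [Subsingleton.elim (Subtype.fintype (· = i)) (Fintype.subtypeEq i)] at hsplit
  exact ((measurePreserving_piUnique fun j : {j : ι // j = i} => m j).prod (.id _)).comp hsplit

/-- The channel from the vector input to the outputs of the channels `K j` at the positions `j`
other than `i`. -/
def extrinsic (i : ι) (K : ι → Kernel ℤˣ EReal) : Kernel (ι → ℤˣ) ({j : ι // j ≠ i} → EReal) :=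
  (memoryless fun j : {j : ι // j ≠ i} => K j).comap (fun x j => x j) (measurable_of_countable _)

instance (i : ι) (K : ι → Kernel ℤˣ EReal) [∀ j, IsMarkovKernel (K j)] :
    IsMarkovKernel (extrinsic i K) := by
  unfold extrinsic
  infer_instance

theorem extrinsic_congr {i : ι} {K L : ι → Kernel ℤˣ EReal} (h : ∀ j ≠ i, K j = L j) :
    extrinsic i K = extrinsic i L := by
  unfold extrinsic
  congr 2
  exact funext fun j => h j j.2

theorem extrinsic_comp (i : ι) (K : ι → Kernel ℤˣ EReal) [∀ j, IsMarkovKernel (K j)]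
    (κ : ι → Kernel EReal EReal) [∀ j, IsMarkovKernel (κ j)] :
    extrinsic i (fun j => κ j ∘ₖ K j) =
      coordinatewise (fun j : {j : ι // j ≠ i} => κ j) ∘ₖ extrinsic i K := by
  unfold extrinsic
  rw [memoryless_comp]
  rfl

theorem memoryless_map_splitAt (i : ι) (K : ι → Kernel ℤˣ EReal) [∀ j, IsMarkovKernel (K j)] :
    (memoryless K).map (splitAt i EReal) =
      ((K i).comap (fun x => x i) (measurable_pi_apply i)) ×ₖ extrinsic i K := by
  ext1 x
  rw [Kernel.map_apply _ (splitAt i EReal).measurable, Kernel.prod_apply]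
  exact (measurePreserving_splitAt i fun j => K j (x j)).map_eq

variable {p : Measure (ι → ℤˣ)} [IsFiniteMeasure p] {K : ι → Kernel ℤˣ EReal}
  [∀ j, IsMarkovKernel (K j)]

theorem isObservation_splitAt (i : ι) :
    IsObservation (p ⊗ₘ memoryless K) Prod.fst (fun ω => splitAt i EReal ω.2) p
      (((K i).comap (fun x => x i) (measurable_pi_apply i)) ×ₖ extrinsic i K) := by
  rw [← memoryless_map_splitAt]
  exact isObservation_compProd.comp (splitAt i EReal).measurable

theorem isObservation_extrinsic (i : ι) :
    IsObservation (p ⊗ₘ memoryless K) Prod.fst (fun ω (j : {j : ι // j ≠ i}) => ω.2 j) p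
      (extrinsic i K) := by
  have h := (isObservation_splitAt (p := p) (K := K) i).comp measurable_snd
  rwa [← Kernel.snd_eq, Kernel.snd_prod] at h

end Memoryless

/-! ### Ordered families of channels -/

/-- A family `(W t)`, `t ∈ [0, 1]`, of BMS channels that is ordered by degradation and absolutely
continuous, with no condition on the channels `W 0` and `W 1`. -/
structure IsOrderedFamily (W : ℝ → Kernel ℤˣ EReal) : Prop where
  markov : ∀ t ∈ Icc (0 : ℝ) 1, IsMarkovKernel (W t)
  symmetric : ∀ t ∈ Icc (0 : ℝ) 1, IsSymmetric (W t)
  degraded : ∀ s t : ℝ, 0 ≤ s → s ≤ t → t ≤ 1 → IsDegraded (W t) (W s)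
  absolutelyContinuous : AbsolutelyContinuousOnInterval (entropyFun W) 0 1

theorem IsBMSFamily.isOrderedFamily {W : ℝ → Kernel ℤˣ EReal} (hW : IsBMSFamily W) :
    IsOrderedFamily W where
  markov := hW.markov
  symmetric := hW.symmetric
  degraded := hW.degraded
  absolutelyContinuous := hW.absolutelyContinuous

theorem IsOrderedFamily.isMonotoneSeries {W : ℝ → Kernel ℤˣ EReal} (hW : IsOrderedFamily W) :
    IsMonotoneSeries (fun k t => entropyTerm (W t) k) (entropyFun W) 0 1 where
  le := zero_le_one
  monotoneOn k s hs t ht hst := by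
    have := hW.markov s hs
    exact entropyTerm_le_of_isDegraded (W s) (hW.degraded s t hs.1 hst ht.2) k
  hasSum t ht := by
    have := hW.markov t ht
    exact hasSum_entropyTerm (W t)
  absolutelyContinuous := hW.absolutelyContinuous

theorem entropyTerm_zero_eq (W : ℝ → Kernel ℤˣ EReal) (t : ℝ) [IsMarkovKernel (W t)] :
    entropyTerm (W t) 0 = gapCoeff 0 * mmseFun W t / Real.log 2 := by
  have hmmse := mmse_eq_one_sub_condMoment (μ := uniformBit ⊗ₘ W t)
    ((measurable_of_countable bitValue).comp measurable_fst) (fun ω => bitValue_sq ω.1)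
    measurable_snd
  exact congrArg (fun u => gapCoeff 0 * u / Real.log 2) hmmse.symm

theorem IsOrderedFamily.strictMonoOn_entropyTerm_zero {W : ℝ → Kernel ℤˣ EReal}
    (hW : IsOrderedFamily W) (hM : StrictMonoOn (mmseFun W) (Icc 0 1)) :
    StrictMonoOn (fun t => entropyTerm (W t) 0) (Icc 0 1) := by
  intro s hs t ht hst
  have := hW.markov s hs
  have := hW.markov t ht
  simp only [entropyTerm_zero_eq]
  exact div_lt_div_of_pos_right (mul_lt_mul_of_pos_left (hM hs ht hst) (gapCoeff_pos 0))
    (Real.log_pos one_lt_two)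

/-! ### The GEXIT function -/

section Gexit

variable {N : ℕ} {W : ℝ → Kernel ℤˣ EReal} {p : Measure (Fin N → ℤˣ)} {i : Fin N} {t : ℝ}

/-- The weight `1 - 𝔼[𝔼[X_i ∣ Y_{∼i}(t)]^(2k+2)]` of the derivative of the `k`-th term of the
entropy series in the GEXIT function. -/
def gexitWeight (W : ℝ → Kernel ℤˣ EReal) (p : Measure (Fin N → ℤˣ)) (i : Fin N) (k : ℕ)
    (t : ℝ) : ℝ :=
  1 - condMoment (jointLaw W p fun _ => t) (fun ω => bitValue (ω.1 i))
    (fun ω (j : {j : Fin N // j ≠ i}) => ω.2 j) k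

variable [IsProbabilityMeasure p]

instance {s : Fin N → ℝ} [∀ j, IsMarkovKernel (W (s j))] :
    IsProbabilityMeasure (jointLaw W p s) := by
  unfold jointLaw
  infer_instance

theorem gexitWeight_mem_Icc [IsMarkovKernel (W t)] (k : ℕ) :
    gexitWeight W p i k t ∈ Icc (0 : ℝ) 1 :=
  Icc.mem_iff_one_sub_mem.1 (condMoment_mem_Icc (fun _ => bitValue_mem_Icc _) (by fun_prop) k)

theorem gexitWeight_zero_le [IsMarkovKernel (W t)] (k : ℕ) :
    gexitWeight W p i 0 t ≤ gexitWeight W p i k t :=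
  sub_le_sub_left
    (condMoment_le_condMoment_zero (fun _ => bitValue_mem_Icc _) (by fun_prop) k) 1

theorem gexitWeight_le [IsMarkovKernel (W t)] (k : ℕ) :
    gexitWeight W p i k t ≤ (k + 1) * gexitWeight W p i 0 t :=
  one_sub_condMoment_le (fun _ => bitValue_mem_Icc _) (by fun_prop) k

theorem gexitWeight_zero [IsMarkovKernel (W t)] :
    gexitWeight W p i 0 t = extrinsicMMSE W p i t :=
  (mmse_eq_one_sub_condMoment (X := fun ω : (Fin N → ℤˣ) × (Fin N → EReal) => bitValue (ω.1 i))
    ((measurable_of_countable fun x : Fin N → ℤˣ => bitValue (x i)).comp measurable_fst)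
    (fun ω => bitValue_sq (ω.1 i)) (by fun_prop)).symm

theorem gexitWeight_eq [IsMarkovKernel (W t)] (k : ℕ) :
    gexitWeight W p i k t =
      1 - ∫ y, posteriorMean (extrinsic i fun _ => W t) p (fun x => bitValue (x i)) y ^ (2 * k + 2)
        ∂((extrinsic i fun _ => W t) ∘ₘ p) := by
  have hobs : IsObservation (jointLaw W p fun _ => t) Prod.fst
      (fun ω (j : {j : Fin N // j ≠ i}) => ω.2 j) p (extrinsic i fun _ => W t) :=
    isObservation_extrinsic i
  exact congrArg (1 - ·) (hobs.condMoment_eq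
    (measurable_of_countable fun x : Fin N → ℤˣ => bitValue (x i)).stronglyMeasurable
    (integrable_bitValue_comp ((measurable_pi_apply i).comp measurable_fst)) k)

theorem gexitWeight_le_of_isDegraded {s : ℝ} [IsMarkovKernel (W s)] [IsMarkovKernel (W t)]
    (h : IsDegraded (W t) (W s)) (k : ℕ) : gexitWeight W p i k s ≤ gexitWeight W p i k t := by
  obtain ⟨κ, _, hcomp⟩ := h
  have hextrinsic : extrinsic i (fun _ => W t) =
      coordinatewise (fun _ => κ) ∘ₖ extrinsic i fun _ => W s := by
    rw [hcomp, extrinsic_comp]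
  rw [gexitWeight_eq, gexitWeight_eq]
  simp only [hextrinsic]
  exact sub_le_sub_left (integral_posteriorMean_comp_pow_le (measurable_of_countable _)
    (fun x : Fin N → ℤˣ => bitValue_mem_Icc (x i)) k) 1

theorem hasSum_partialEntropy {s : ℝ} [IsMarkovKernel (W s)] [IsMarkovKernel (W t)]
    (hs : IsSymmetric (W s)) :
    HasSum (fun k => gexitWeight W p i k t * entropyTerm (W s) k)
      (partialEntropy W p i t s -
        residualEntropy (extrinsic i fun _ => W t) p (fun x => x i)) := by
  have hmarkov : ∀ j, IsMarkovKernel (W (Function.update (fun _ => t) i s j)) := fun j => by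
    by_cases hj : j = i
    · rwa [hj, Function.update_self]
    · rwa [Function.update_of_ne hj]
  have hobs := isObservation_splitAt (p := p)
    (K := fun j => W (Function.update (fun _ => t) i s j)) i
  simp only [Function.update_self] at hobs
  rw [extrinsic_congr (L := fun _ => W t) fun j hj => by rw [Function.update_of_ne hj]] at hobs
  have hsum := hobs.hasSum_condEntropy hs
  rw [condEntropy_comp_measurableEquiv] at hsum
  simp only [gexitWeight_eq]
  exact hsum

end Gexit

namespace IsOrderedFamily

variable {N : ℕ} {W : ℝ → Kernel ℤˣ EReal} (hW : IsOrderedFamily W) (p : Measure (Fin N → ℤˣ))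
  [IsProbabilityMeasure p] (i : Fin N)
include hW

theorem monotoneOn_gexitWeight (k : ℕ) : MonotoneOn (gexitWeight W p i k) (Icc 0 1) := by
  intro s hs t ht hst
  have := hW.markov s hs
  have := hW.markov t ht
  exact gexitWeight_le_of_isDegraded (hW.degraded s t hs.1 hst ht.2) k

theorem ae_hasSum_gexit : ∀ᵐ t ∂(volume.restrict (Ioo 0 1)),
    DifferentiableAt ℝ (partialEntropy W p i t) t ∧
      HasSum (fun k => gexitWeight W p i k t * deriv (fun t => entropyTerm (W t) k) t)
        (gexit W p i t) := by
  have hsum : ∀ t ∈ Icc (0 : ℝ) 1, ∃ c, ∀ s ∈ Icc (0 : ℝ) 1,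
      HasSum (fun k => gexitWeight W p i k t * entropyTerm (W s) k)
        (partialEntropy W p i t s - c) := fun t ht => by
    have := hW.markov t ht
    exact ⟨_, fun s hs => have := hW.markov s hs; hasSum_partialEntropy (hW.symmetric s hs)⟩
  choose! c hc using hsum
  filter_upwards [ae_restrict_mem measurableSet_Ioo,
    hW.isMonotoneSeries.ae_hasSum_deriv_of_hasSum_mul
      (fun k t ht => have := hW.markov t ht; gexitWeight_mem_Icc k) hc] with t ht ⟨hdiff, hderiv⟩
  rw [gexit, derivWithin_of_mem_nhds (Icc_mem_nhds ht.1 ht.2)]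
  exact ⟨hdiff, hderiv⟩

theorem isWeightedDeriv_gexit :
    IsWeightedDeriv (fun k t => entropyTerm (W t) k) (gexitWeight W p i) (gexit W p i) 0 1 where
  aemeasurable k := aemeasurable_restrict_of_monotoneOn measurableSet_Ioo
    ((hW.monotoneOn_gexitWeight p i k).mono Ioo_subset_Icc_self)
  mem_Icc k t ht := have := hW.markov t ht; gexitWeight_mem_Icc k
  ae_hasSum := (hW.ae_hasSum_gexit p i).mono fun _ h => h.2

theorem ae_differentiableWithinAt_partialEntropy : ∀ᵐ t ∂(volume.restrict (Icc 0 1)),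
    DifferentiableWithinAt ℝ (partialEntropy W p i t) (Icc 0 1) t := by
  rw [← restrict_Ioo_eq_restrict_Icc]
  exact (hW.ae_hasSum_gexit p i).mono fun _ h => h.1.differentiableWithinAt

end IsOrderedFamily

/-! ### Limits of the integrals -/

namespace IsOrderedFamily

variable {W : ℝ → Kernel ℤˣ EReal} (hW : IsOrderedFamily W)
  (hM : StrictMonoOn (mmseFun W) (Icc 0 1)) {N : ℕ → ℕ} (p : ∀ n, Measure (Fin (N n) → ℤˣ))
  [∀ n, IsProbabilityMeasure (p n)] (i : ∀ n, Fin (N n)) {t' : ℝ} (ht' : t' ∈ Icc (0 : ℝ) 1)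
include hW hM ht'

theorem tendsto_integral_gexit_iff :
    Tendsto (fun n => ∫ s in (0 : ℝ)..t', gexit W (p n) (i n) s) atTop (𝓝 0) ↔
      ∀ s ∈ Ico 0 t', Tendsto (fun n => extrinsicMMSE W (p n) (i n) s) atTop (𝓝 0) := by
  have hsub : Icc 0 t' ⊆ Icc (0 : ℝ) 1 := Icc_subset_Icc_right ht'.2
  rw [tendsto_integral_zero_iff_of_monotone_weights (C := fun k => k + 1)
    (hW.isMonotoneSeries.mono le_rfl ht'.1 ht'.2)
    ((hW.strictMonoOn_entropyTerm_zero hM).mono hsub)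
    (fun n => (hW.isWeightedDeriv_gexit (p n) (i n)).mono le_rfl ht'.2)
    (fun n k t ht => have := hW.markov t (hsub ht); gexitWeight_le k)
    fun n => (hW.monotoneOn_gexitWeight (p n) (i n) 0).mono hsub]
  refine forall₂_congr fun s hs => ?_
  have := hW.markov s (hsub (Ico_subset_Icc_self hs))
  simp only [gexitWeight_zero]

theorem tendsto_integral_entropyDeriv_sub_gexit_iff :
    Tendsto (fun n => ∫ s in t'..(1 : ℝ), (entropyDeriv W s - gexit W (p n) (i n) s)) atTop (𝓝 0) ↔
      ∀ s ∈ Ioc t' 1, Tendsto (fun n => extrinsicMMSE W (p n) (i n) s) atTop (𝓝 1) := by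
  have hsub : Icc t' 1 ⊆ Icc (0 : ℝ) 1 := Icc_subset_Icc_left ht'.1
  have hweight : ∀ n, IsWeightedDeriv (fun k t => entropyTerm (W t) k)
      (fun k t => 1 - gexitWeight W (p n) (i n) k t)
      (fun t => entropyDeriv W t - gexit W (p n) (i n) t) t' 1 := fun n =>
    ((hW.isWeightedDeriv_gexit (p n) (i n)).one_sub hW.isMonotoneSeries).mono ht'.1 le_rfl
  rw [tendsto_integral_zero_iff_of_antitone_weights (C := fun _ => 1)
    (hW.isMonotoneSeries.mono ht'.1 ht'.2 le_rfl)
    ((hW.strictMonoOn_entropyTerm_zero hM).mono hsub) hweight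
    (fun n k t ht => have := hW.markov t (hsub ht); by
      rw [one_mul]
      exact sub_le_sub_left (gexitWeight_zero_le k) 1)
    fun n s hs t ht hst =>
      sub_le_sub_left (hW.monotoneOn_gexitWeight (p n) (i n) 0 (hsub hs) (hsub ht) hst) 1]
  refine forall₂_congr fun s hs => ?_
  have := hW.markov s (hsub (Ioc_subset_Icc_self hs))
  simp only [gexitWeight_zero]
  rw [← sub_self (1 : ℝ), tendsto_const_sub_iff]

end IsOrderedFamily

end BMS

end

theorem mainTheorem11_general (W : ℝ → Kernel ℤˣ EReal) (hW : BMS.IsOrderedFamily W)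
    (hM : StrictMonoOn (BMS.mmseFun W) (Icc 0 1))
    (N : ℕ → ℕ) (p : ∀ n, Measure (Fin (N n) → ℤˣ)) [∀ n, IsProbabilityMeasure (p n)]
    (i : ∀ n, Fin (N n)) :
    (∀ n, (∀ᵐ t ∂(volume.restrict (Icc (0 : ℝ) 1)),
          DifferentiableWithinAt ℝ (BMS.partialEntropy W (p n) (i n) t) (Icc 0 1) t) ∧
        IntervalIntegrable (BMS.gexit W (p n) (i n)) volume 0 1) ∧
    ∀ t' ∈ Ioo (0 : ℝ) 1,
      (Tendsto (fun n => ∫ s in (0 : ℝ)..t', BMS.gexit W (p n) (i n) s) atTop (𝓝 0) ↔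
        ∀ s ∈ Ico 0 t', Tendsto (fun n => BMS.extrinsicMMSE W (p n) (i n) s) atTop (𝓝 0)) ∧
      (Tendsto (fun n => ∫ s in t'..(1 : ℝ), (BMS.entropyDeriv W s - BMS.gexit W (p n) (i n) s))
          atTop (𝓝 0) ↔
        ∀ s ∈ Ioc t' 1, Tendsto (fun n => BMS.extrinsicMMSE W (p n) (i n) s) atTop (𝓝 1)) :=
  ⟨fun n => ⟨hW.ae_differentiableWithinAt_partialEntropy (p n) (i n),
    (hW.isWeightedDeriv_gexit (p n) (i n)).intervalIntegrable hW.isMonotoneSeries⟩,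
    fun _ ht' => ⟨hW.tendsto_integral_gexit_iff hM p i (Ioo_subset_Icc_self ht'),
      hW.tendsto_integral_entropyDeriv_sub_gexit_iff hM p i (Ioo_subset_Icc_self ht')⟩⟩

theorem mainTheorem11 (W : ℝ → Kernel ℤˣ EReal) (hW : BMS.IsBMSFamily W)
    (hM : StrictMonoOn (BMS.mmseFun W) (Icc 0 1))
    (N : ℕ → ℕ) (p : ∀ n, Measure (Fin (N n) → ℤˣ)) (hp : ∀ n, IsProbabilityMeasure (p n))
    (i : ∀ n, Fin (N n)) :
    (∀ n, (∀ᵐ t ∂(volume.restrict (Icc (0 : ℝ) 1)),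
          DifferentiableWithinAt ℝ (BMS.partialEntropy W (p n) (i n) t) (Icc 0 1) t) ∧
        IntervalIntegrable (BMS.gexit W (p n) (i n)) volume 0 1) ∧
    ∀ t' ∈ Ioo (0 : ℝ) 1,
      (Tendsto (fun n => ∫ s in (0 : ℝ)..t', BMS.gexit W (p n) (i n) s) atTop (𝓝 0) ↔
        ∀ s ∈ Ico 0 t', Tendsto (fun n => BMS.extrinsicMMSE W (p n) (i n) s) atTop (𝓝 0)) ∧
      (Tendsto (fun n => ∫ s in t'..(1 : ℝ), (BMS.entropyDeriv W s - BMS.gexit W (p n) (i n) s))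
          atTop (𝓝 0) ↔
        ∀ s ∈ Ioc t' 1, Tendsto (fun n => BMS.extrinsicMMSE W (p n) (i n) s) atTop (𝓝 1)) :=
  mainTheorem11_general W hW.isOrderedFamily hM N p i
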